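/- Let $\chi:\mathbb R\to[0,\infty)$ be a $C^\infty$ function with $\chi(s)=0$ for $s\le 1$, $s-2\le\chi(s)\le s-1$ for $s\ge 1$, and $\chi'(s)>0$ for $s>1$; such functions exist. For $\lambda\in\mathbb R$ put $F_\lambda(s)=\chi(s)^3-\lambda\chi(s)^4$ and $f_\lambda=F_\lambda'$. For a continuous $f:\mathbb R\to\mathbb R$, with primitive $F(u)=\int_0^u f(s)\,ds$, let $$I_f(\psi)=\int_0^1\Big(\tfrac12|\psi'(t)|^2-F(\psi(t))\Big)\,dt,\qquad \psi\in H^1_0(0,1),$$ where elements of $H_0^1(0,1)$ are identified with their continuous representatives on $[0,1]$. Let $$\mathcal E=\Big\{\lambda>0:\ \inf_{\psi\in H_0^1(0,1)} I_{2+f_\lambda}(\psi)<-\tfrac16\Big\}.$$ Then $\mathcal E$ is nonempty and bounded above. Put $\hat\lambda^*=\sup\mathcal E$. The function $f=2+f_{\hat\lambda^*}$ is $C^\infty$, the function $\phi(t)=t(1-t)$ is a global minimizer of $I_f$ on $H_0^1(0,1)$, and there is a second global minimizer $\varphi\in H^1_0(0,1)$ of $I_f$ such that 1. $\phi<\varphi$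 in $(0,1)$; 2. if $\eta\in H_0^1(0,1)$ is a global minimizer of $I_f$ with $\phi\le\eta\le\varphi$ on $[0,1]$, then $\eta\equiv\phi$ or $\eta\equiv\varphi$; 3. $\phi$ and $\varphi$ are strictly positive in $(0,1)$, and $\varphi(1-t)=\varphi(t)$ for all $t\in[0,1]$. -/

import Mathlib

open Set MeasureTheory
open scoped ContDiff

noncomputable section

/-- `g` is a weak (distributional) derivative of `ψ` on the interval `(0, 1)`: tested against every
`η ∈ C_c^∞(0, 1)`. -/
def HasWeakDerivUnit (ψ g : ℝ → ℝ) : Prop :=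
  ∀ η : ℝ → ℝ, ContDiff ℝ ∞ η → HasCompactSupport η → tsupport η ⊆ Ioo (0 : ℝ) 1 →
    ∫ t in Ioo (0 : ℝ) 1, ψ t * deriv η t = -∫ t in Ioo (0 : ℝ) 1, g t * η t

/-- The space of `ψ ∈ H¹(0, 1)` with `ψ(0) = 0` and `ψ(1) = c`. As usual in dimension one, an
element of `H¹(0, 1)` is identified with its representative that is continuous on `[0, 1]`; only
the values on `[0, 1]` matter. -/
structure MemH1Bdry (c : ℝ) (ψ : ℝ → ℝ) : Prop where
  continuousOn : ContinuousOn ψ (Icc 0 1)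
  memLp : MemLp ψ 2 (volume.restrict (Ioo (0 : ℝ) 1))
  exists_weakDeriv :
    ∃ g : ℝ → ℝ, MemLp g 2 (volume.restrict (Ioo (0 : ℝ) 1)) ∧ HasWeakDerivUnit ψ g
  left : ψ 0 = 0
  right : ψ 1 = c

open Classical in
/-- The weak derivative in `L²(0, 1)` (unique up to null sets), and `0` if there is none. -/
def weakDerivUnit (ψ : ℝ → ℝ) : ℝ → ℝ :=
  if h : ∃ g : ℝ → ℝ, MemLp g 2 (volume.restrict (Ioo (0 : ℝ) 1)) ∧ HasWeakDerivUnit ψ g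
  then h.choose else 0

/-- The primitive `F(u) = ∫₀ᵘ f(s) ds`. -/
def primitive (f : ℝ → ℝ) (u : ℝ) : ℝ := ∫ s in (0 : ℝ)..u, f s

/-- The energy `I(ψ) = ∫₀¹ (½ |ψ'|² - F(ψ)) dt`, with `ψ'` the weak derivative. -/
def energy (f ψ : ℝ → ℝ) : ℝ :=
  ∫ t in Ioo (0 : ℝ) 1, ((1 / 2) * (weakDerivUnit ψ t) ^ 2 - primitive f (ψ t))

/-- `ψ` is a global minimizer of the energy over `{ψ ∈ H¹(0, 1) : ψ(0) = 0, ψ(1) = c}`. -/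
def IsGlobalMinimizer (f : ℝ → ℝ) (c : ℝ) (ψ : ℝ → ℝ) : Prop :=
  MemH1Bdry c ψ ∧ ∀ η : ℝ → ℝ, MemH1Bdry c η → energy f ψ ≤ energy f η

/-- `φ` and `ϕ` are two ordered global minimizers without a further global minimizer in between. -/
structure AdjacentMinimizers (f : ℝ → ℝ) (c : ℝ) (φ ϕ : ℝ → ℝ) : Prop where
  lower_min : IsGlobalMinimizer f c φ
  upper_min : IsGlobalMinimizer f c ϕ
  lt : ∀ t ∈ Ioo (0 : ℝ) 1, φ t < ϕ t
  none_between : ∀ η : ℝ → ℝ, IsGlobalMinimizer f c η →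
    (∀ t ∈ Icc (0 : ℝ) 1, φ t ≤ η t ∧ η t ≤ ϕ t) →
    EqOn η φ (Icc 0 1) ∨ EqOn η ϕ (Icc 0 1)

/-- The smooth truncations `χ` of `s ↦ (s - 1)⁺` from which the nonlinearity is built. -/
structure IsTruncation (χ : ℝ → ℝ) : Prop where
  smooth : ContDiff ℝ ∞ χ
  nonneg : ∀ s, 0 ≤ χ s
  eq_zero : ∀ s ≤ 1, χ s = 0
  le_sub_one : ∀ s, 1 ≤ s → χ s ≤ s - 1
  sub_two_le : ∀ s, 1 ≤ s → s - 2 ≤ χ s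
  deriv_pos : ∀ s, 1 < s → 0 < deriv χ s

/-- `F_l(s) = χ(s)³ - l χ(s)⁴`. -/
def potentialF (χ : ℝ → ℝ) (l s : ℝ) : ℝ := χ s ^ 3 - l * χ s ^ 4

/-- The nonlinearity `2 + f_l`, where `f_l = F_l'`. -/
def nonlinearity (χ : ℝ → ℝ) (l s : ℝ) : ℝ := 2 + deriv (potentialF χ l) s

/-- The infimum over `H₀¹(0, 1)` of the energy with nonlinearity `2 + f_l`, as an extended real. -/
def minEnergy (χ : ℝ → ℝ) (l : ℝ) : EReal :=
  ⨅ ψ : {ψ : ℝ → ℝ // MemH1Bdry 0 ψ}, ((energy (nonlinearity χ l) ψ.1 : ℝ) : EReal)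

/-- The set of `l > 0` for which the infimum of the energy is less than `-1/6`. -/
def lowEnergySet (χ : ℝ → ℝ) : Set ℝ :=
  {l : ℝ | 0 < l ∧ minEnergy χ l < ((-1 / 6 : ℝ) : EReal)}

/-- The critical parameter, the supremum of `lowEnergySet χ`. -/
def criticalParam (χ : ℝ → ℝ) : ℝ := sSup (lowEnergySet χ)

end

/-! ### Primitives of square-integrable functions on the unit interval -/

/-! Write ψ = t(1-t) + w with w the primitive of a mean-zero h ∈ L². Since t(1-t) solves -φ'' = 2,
the terms linear in w cancel and the energy is -1/6 + `excess`, where `excess` is ½∫h² minus the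
integral of F_l along ψ (`Admissible.energy_eq`). Everything is a study of the sign of `excess`.

Two facts drive the proof. As t(1-t) ≤ 1/4 and F_l vanishes on s ≤ 1, the potential is felt only
where w > 3/4; as w² ≤ ∫h², a nonzero potential term forces ∫h² ≥ 9/16 (`MemL2Unit.dirichlet_ge`).
And F_l ≤ 27/(256 l³), which bounds ∫h² whenever the excess is nonpositive. Hence weak limits of
competitors of nonpositive excess and nonzero potential term keep both properties
(`exists_limit_excess_nonpos`).

At the critical parameter the excess is nonnegative, being continuous in l, so t(1-t) is a
minimizer; competitors of negative excess for l increasing to the supremum converge to a nontrivial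
one (`exists_isCritical`). By the same compactness, some nontrivial minimizer has least ∫w, which
leaves no room for another one below it.

Positivity of w replaces the maximum principle by an energy comparison: where w ≤ 3/4, replacing w
by a chord leaves the potential term unchanged, so w is affine there (`IsCritical.primitive_affine`,
`IsCritical.primitive_pos`). Symmetry comes from exchanging halves of w and its reflection: the two
results share the total energy and the total integral, so both are again minimizers of least
integral. -/

/-- `g` is square-integrable on the unit interval. -/
abbrev MemL2Unit (g : ℝ → ℝ) : Prop := MemLp g 2 (volume.restrict (Ioo (0 : ℝ) 1))

theorem integral_Ioo_eq_interval (f : ℝ → ℝ) :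
    ∫ t in Ioo (0 : ℝ) 1, f t = ∫ t in (0 : ℝ)..1, f t := by
  rw [intervalIntegral.integral_of_le zero_le_one, integral_Ioc_eq_integral_Ioo]

theorem IntegrableOn.intervalIntegrable_of_mem_Icc {f : ℝ → ℝ} (hf : IntegrableOn f (Ioo 0 1))
    {p q : ℝ} (hp : p ∈ Icc (0 : ℝ) 1) (hq : q ∈ Icc (0 : ℝ) 1) :
    IntervalIntegrable f volume p q := by
  rw [intervalIntegrable_iff]
  rw [← integrableOn_Ioc_iff_integrableOn_Ioo] at hf
  refine hf.mono_set ?_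
  rw [uIoc]
  exact Ioc_subset_Ioc (le_min hp.1 hq.1) (max_le hp.2 hq.2)

theorem ContinuousOn.integrableOn_Ioo_unit {f : ℝ → ℝ} (hf : ContinuousOn f (Icc 0 1)) :
    IntegrableOn f (Ioo (0 : ℝ) 1) :=
  (hf.integrableOn_compact isCompact_Icc).mono_set Ioo_subset_Icc_self

theorem ContinuousOn.memL2Unit {f : ℝ → ℝ} (hf : ContinuousOn f (Icc 0 1)) : MemL2Unit f := by
  obtain ⟨C, hC⟩ := isCompact_Icc.exists_bound_of_continuousOn hf
  refine MemLp.of_bound (hf.integrableOn_Ioo_unit).aestronglyMeasurable C ?_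
  filter_upwards [ae_restrict_mem measurableSet_Ioo] with t ht
  exact hC t (Ioo_subset_Icc_self ht)

theorem MemL2Unit.integrableOn {g : ℝ → ℝ} (hg : MemL2Unit g) : IntegrableOn g (Ioo 0 1) :=
  MemLp.integrable (by norm_num) hg

theorem MemL2Unit.intervalIntegrable {g : ℝ → ℝ} (hg : MemL2Unit g)
    {p q : ℝ} (hp : p ∈ Icc (0 : ℝ) 1) (hq : q ∈ Icc (0 : ℝ) 1) :
    IntervalIntegrable g volume p q :=
  IntegrableOn.intervalIntegrable_of_mem_Icc hg.integrableOn hp hq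

theorem MemL2Unit.intervalIntegrable_sq {g : ℝ → ℝ} (hg : MemL2Unit g)
    {p q : ℝ} (hp : p ∈ Icc (0 : ℝ) 1) (hq : q ∈ Icc (0 : ℝ) 1) :
    IntervalIntegrable (fun t => g t ^ 2) volume p q :=
  IntegrableOn.intervalIntegrable_of_mem_Icc (MemLp.integrable_sq hg) hp hq

theorem MemL2Unit.intervalIntegrable_mul {g k : ℝ → ℝ} (hg : MemL2Unit g) (hk : MemL2Unit k)
    {p q : ℝ} (hp : p ∈ Icc (0 : ℝ) 1) (hq : q ∈ Icc (0 : ℝ) 1) :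
    IntervalIntegrable (fun t => g t * k t) volume p q :=
  IntegrableOn.intervalIntegrable_of_mem_Icc (MemLp.integrable_mul hg hk) hp hq

theorem zero_mem_unit : (0 : ℝ) ∈ Icc (0 : ℝ) 1 := ⟨le_rfl, zero_le_one⟩
theorem one_mem_unit : (1 : ℝ) ∈ Icc (0 : ℝ) 1 := ⟨zero_le_one, le_rfl⟩

theorem primitive_zero (g : ℝ → ℝ) : primitive g 0 = 0 := by simp [primitive]

theorem MemL2Unit.primitive_continuousOn {g : ℝ → ℝ} (hg : MemL2Unit g) :
    ContinuousOn (primitive g) (Icc 0 1) := by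
  have := intervalIntegral.continuousOn_primitive_interval (a := 0) (b := 1) (f := g)
    (μ := volume) (by rw [uIcc_of_le zero_le_one, integrableOn_Icc_iff_integrableOn_Ioo]
                      exact hg.integrableOn)
  rwa [uIcc_of_le zero_le_one] at this

/-- Integration by parts of a primitive against a `C¹` function. -/
theorem MemL2Unit.integral_primitive_mul_deriv {g k : ℝ → ℝ} (hg : MemL2Unit g)
    (hk : ContDiff ℝ 1 k) :
    ∫ t in (0 : ℝ)..1, primitive g t * deriv k t
      = primitive g 1 * k 1 - ∫ t in (0 : ℝ)..1, g t * k t := by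
  have hi := hg.intervalIntegrable zero_mem_unit one_mem_unit
  have hG : AbsolutelyContinuousOnInterval (primitive g) 0 1 :=
    hi.absolutelyContinuousOnInterval_intervalIntegral (c := 0) (by simp)
  have hK : AbsolutelyContinuousOnInterval k 0 1 :=
    hk.contDiffOn.absolutelyContinuousOnInterval
  rw [hG.integral_mul_deriv_eq_deriv_mul hK, primitive_zero, zero_mul, sub_zero]
  congr 1
  apply intervalIntegral.integral_congr_ae
  filter_upwards [hi.ae_hasDerivAt_integral] with t ht htm
  have := (ht (uIoc_subset_uIcc htm) 0 (by simp)).deriv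
  change deriv (primitive g) t = _ at this
  rw [this]

theorem MemL2Unit.hasWeakDerivUnit_primitive {g : ℝ → ℝ} (hg : MemL2Unit g) :
    HasWeakDerivUnit (primitive g) g := by
  intro η hη _ hs
  rw [integral_Ioo_eq_interval, integral_Ioo_eq_interval,
    hg.integral_primitive_mul_deriv (hη.of_le (by exact_mod_cast le_top))]
  have : η 1 = 0 := by
    by_contra h
    exact lt_irrefl _ (hs (subset_tsupport _ h)).2
  rw [this]; ring

theorem integral_Ioo_mul_eq_integral {u η : ℝ → ℝ} (hs : tsupport η ⊆ Ioo (0 : ℝ) 1) :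
    ∫ t in Ioo (0 : ℝ) 1, u t * η t = ∫ t, u t * η t := by
  refine setIntegral_eq_integral_of_forall_compl_eq_zero fun t ht => ?_
  have : η t = 0 := by
    by_contra h
    exact ht (hs (subset_tsupport _ h))
  rw [this, mul_zero]

/-- The weak derivative is unique almost everywhere. -/
theorem HasWeakDerivUnit.ae_eq {ψ g k : ℝ → ℝ} (hg : HasWeakDerivUnit ψ g)
    (hk : HasWeakDerivUnit ψ k) (hg2 : MemL2Unit g) (hk2 : MemL2Unit k) :
    g =ᵐ[volume.restrict (Ioo (0 : ℝ) 1)] k := by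
  have hd : MemL2Unit (g - k) := hg2.sub hk2
  have := isOpen_Ioo.ae_eq_zero_of_integral_contDiff_smul_eq_zero (U := Ioo (0 : ℝ) 1)
    (μ := volume) (f := g - k) hd.integrableOn.locallyIntegrableOn (fun η hη hc hs => by
      have e := (hg η hη hc hs).symm.trans (hk η hη hc hs)
      have hηm : MemL2Unit η := hη.continuous.continuousOn.memL2Unit
      have i1 : Integrable (fun t => g t * η t) (volume.restrict (Ioo 0 1)) :=
        MemLp.integrable_mul hg2 hηm
      have i2 : Integrable (fun t => k t * η t) (volume.restrict (Ioo 0 1)) :=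
        MemLp.integrable_mul hk2 hηm
      calc ∫ t, η t • (g - k) t = ∫ t, (g t - k t) * η t := by
            congr 1; ext t; simp [mul_comm]
        _ = ∫ t in Ioo (0 : ℝ) 1, (g t - k t) * η t :=
            (integral_Ioo_mul_eq_integral (u := fun t => g t - k t) hs).symm
        _ = (∫ t in Ioo (0 : ℝ) 1, g t * η t) - ∫ t in Ioo (0 : ℝ) 1, k t * η t := by
            rw [← integral_sub i1 i2]; simp only [sub_mul]
        _ = 0 := by linarith)
  rw [Filter.EventuallyEq, ae_restrict_iff' measurableSet_Ioo]
  filter_upwards [this] with t ht h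
  exact sub_eq_zero.1 (ht h)

/-- A smooth function supported in `(0, 1)` with vanishing integral is the derivative of a test
function. -/
theorem exists_testFunction_deriv_eq {ξ : ℝ → ℝ} (hξ : ContDiff ℝ ∞ ξ) (hc : HasCompactSupport ξ)
    (hs : tsupport ξ ⊆ Ioo (0 : ℝ) 1) (h0 : ∫ t in (0 : ℝ)..1, ξ t = 0) :
    ∃ η : ℝ → ℝ, ContDiff ℝ ∞ η ∧ HasCompactSupport η ∧ tsupport η ⊆ Ioo (0 : ℝ) 1 ∧
      deriv η = ξ := by
  have hd : ∀ t, HasDerivAt (primitive ξ) (ξ t) t := fun t =>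
    intervalIntegral.integral_hasDerivAt_right (hξ.continuous.intervalIntegrable _ _)
      (hξ.continuous.stronglyMeasurableAtFilter _ _) hξ.continuous.continuousAt
  have hde : deriv (primitive ξ) = ξ := funext fun t => (hd t).deriv
  -- The compact support leaves a margin at both ends of the interval. If it is empty, any interval
  -- will do.
  obtain ⟨a, b, ha, hb, hab⟩ : ∃ a b : ℝ, 0 < a ∧ b < 1 ∧ tsupport ξ ⊆ Icc a b := by
    rcases (tsupport ξ).eq_empty_or_nonempty with h | h
    · exact ⟨1 / 2, 1 / 2, by norm_num, by norm_num, by simp [h]⟩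
    · refine ⟨sInf (tsupport ξ), sSup (tsupport ξ), (hs (hc.sInf_mem h)).1,
        (hs (hc.sSup_mem h)).2, fun t ht => ⟨csInf_le hc.bddBelow ht, le_csSup hc.bddAbove ht⟩⟩
  have hz : ∀ t, t ∉ Icc a b → ξ t = 0 := fun t ht => by
    by_contra h
    exact ht (hab (subset_tsupport _ h))
  have hsupp : Function.support (primitive ξ) ⊆ Icc a b := by
    intro t ht
    by_contra hn
    apply ht
    rw [mem_Icc, not_and_or, not_le, not_le] at hn
    rcases hn with hn | hn
    · refine intervalIntegral.integral_zero_ae (Filter.Eventually.of_forall fun s hs' => hz s ?_)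
      intro hsm
      have : s ≤ max 0 t := hs'.2
      exact absurd hsm.1 (not_le.2 (this.trans_lt (max_lt ha hn)))
    -- To the right of b the vanishing integral over (0, 1) is what makes the primitive return to
    -- zero.
    · have e : primitive ξ t = primitive ξ 1 + ∫ s in (1 : ℝ)..t, ξ s :=
        (intervalIntegral.integral_add_adjacent_intervals
          (hξ.continuous.intervalIntegrable _ _) (hξ.continuous.intervalIntegrable _ _)).symm
      rw [e, primitive, h0, zero_add]
      refine intervalIntegral.integral_zero_ae (Filter.Eventually.of_forall fun s hs' => hz s ?_)
      intro hsm
      have : min 1 t < s := hs'.1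
      exact absurd hsm.2 (not_le.2 ((lt_min hb hn).trans this))
  have hts : tsupport (primitive ξ) ⊆ Icc a b := closure_minimal hsupp isClosed_Icc
  exact ⟨primitive ξ, contDiff_infty_iff_deriv.2 ⟨fun t => (hd t).differentiableAt, by rwa [hde]⟩,
    isCompact_Icc.of_isClosed_subset (isClosed_tsupport _) hts,
    hts.trans fun t ht => ⟨ha.trans_le ht.1, ht.2.trans_lt hb⟩, hde⟩

/-- A continuous function on `[0, 1]` with vanishing weak derivative is constant. -/
theorem HasWeakDerivUnit.eqOn_const {ψ : ℝ → ℝ} (hψ : ContinuousOn ψ (Icc 0 1))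
    (h : HasWeakDerivUnit ψ 0) : ∃ c, ∀ t ∈ Icc (0 : ℝ) 1, ψ t = c := by
  let B : ContDiffBump (1 / 2 : ℝ) := ⟨1 / 8, 1 / 4, by norm_num, by norm_num⟩
  set β : ℝ → ℝ := B.normed volume
  have hβ : ContDiff ℝ ∞ β := B.contDiff_normed
  have hβc : HasCompactSupport β := B.hasCompactSupport_normed
  have hβs : tsupport β ⊆ Ioo (0 : ℝ) 1 := by
    rw [B.tsupport_normed_eq, Real.closedBall_eq_Icc]
    intro t ht
    change 1 / 2 - 1 / 4 ≤ t ∧ t ≤ 1 / 2 + 1 / 4 at ht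
    exact ⟨by linarith [ht.1], by linarith [ht.2]⟩
  have hβ1 : ∫ t in Ioo (0 : ℝ) 1, β t = 1 := by
    have := integral_Ioo_mul_eq_integral (u := fun _ => 1) hβs
    simp only [one_mul] at this
    rw [this]; exact B.integral_normed
  -- The constant must be the average of ψ against the unit-mass bump β.
  set c : ℝ := ∫ t in Ioo (0 : ℝ) 1, ψ t * β t
  have hψ2 : MemL2Unit ψ := hψ.memL2Unit
  have hψc : MemL2Unit (fun t => ψ t - c) := (hψ.sub continuousOn_const).memL2Unit
  have key : ∀ η : ℝ → ℝ, ContDiff ℝ ∞ η → HasCompactSupport η → tsupport η ⊆ Ioo (0 : ℝ) 1 →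
      ∫ t, η t • (ψ t - c) = 0 := by
    intro η hη hc hs
    set m : ℝ := ∫ t in Ioo (0 : ℝ) 1, η t
    have iη : IntegrableOn η (Ioo 0 1) := hη.continuous.continuousOn.integrableOn_Ioo_unit
    have iβ : IntegrableOn β (Ioo 0 1) := hβ.continuous.continuousOn.integrableOn_Ioo_unit
    have iψη : IntegrableOn (fun t => ψ t * η t) (Ioo 0 1) :=
      MemLp.integrable_mul hψ2 hη.continuous.continuousOn.memL2Unit
    have iψβ : IntegrableOn (fun t => ψ t * β t) (Ioo 0 1) :=
      MemLp.integrable_mul hψ2 hβ.continuous.continuousOn.memL2Unit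
    -- Du Bois-Reymond: subtracting m β from η removes its mean, so the difference is the derivative
    -- of a test function and may be inserted in the hypothesis.
    obtain ⟨ζ, hζ, hζc, hζs, hζd⟩ := exists_testFunction_deriv_eq
      (ξ := fun t => η t - m * β t) (hη.sub (contDiff_const.mul hβ))
      (hc.sub (hβc.mul_left (f := fun _ => m)))
      ((tsupport_sub _ _).trans (union_subset hs ((tsupport_mul_subset_right
        (f := fun _ => m) (g := β)).trans hβs)))
      (by
        rw [← integral_Ioo_eq_interval, integral_sub iη (iβ.const_mul m), integral_const_mul, hβ1]
        simp [m])
    have e := h ζ hζ hζc hζs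
    rw [hζd] at e
    simp only [Pi.zero_apply, zero_mul, integral_zero, neg_zero] at e
    have e2 : ∫ t in Ioo (0 : ℝ) 1, ψ t * (η t - m * β t)
        = (∫ t in Ioo (0 : ℝ) 1, ψ t * η t) - m * c := by
      rw [← integral_const_mul, ← integral_sub iψη (iψβ.const_mul m)]
      congr 1; ext t; ring
    calc ∫ t, η t • (ψ t - c) = ∫ t, (ψ t - c) * η t := by
          congr 1; ext t; simp [mul_comm]
      _ = ∫ t in Ioo (0 : ℝ) 1, (ψ t - c) * η t :=
          (integral_Ioo_mul_eq_integral (u := fun t => ψ t - c) hs).symm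
      _ = (∫ t in Ioo (0 : ℝ) 1, ψ t * η t) - c * m := by
          rw [← integral_const_mul, ← integral_sub iψη (iη.const_mul c)]
          congr 1; ext t; ring
      _ = 0 := by linarith
  have hae := isOpen_Ioo.ae_eq_zero_of_integral_contDiff_smul_eq_zero (U := Ioo (0 : ℝ) 1)
    (μ := volume) (f := fun t => ψ t - c) hψc.integrableOn.locallyIntegrableOn key
  refine ⟨c, Measure.eqOn_Icc_of_ae_eq volume zero_ne_one ?_ hψ continuousOn_const⟩
  rw [Measure.restrict_congr_set Ioo_ae_eq_Icc.symm, Filter.EventuallyEq,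
    ae_restrict_iff' measurableSet_Ioo]
  filter_upwards [hae] with t ht hm
  exact sub_eq_zero.1 (ht hm)

theorem exists_weakDeriv_spec {ψ : ℝ → ℝ}
    (h : ∃ g : ℝ → ℝ, MemL2Unit g ∧ HasWeakDerivUnit ψ g) :
    MemL2Unit (weakDerivUnit ψ) ∧ HasWeakDerivUnit ψ (weakDerivUnit ψ) := by
  rw [weakDerivUnit, dif_pos h]
  exact h.choose_spec

/-- An element of `H¹(0, 1)` vanishing at `0` is the primitive of its weak derivative. -/
theorem MemH1Bdry.eq_primitive {c : ℝ} {ψ : ℝ → ℝ} (h : MemH1Bdry c ψ) :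
    MemL2Unit (weakDerivUnit ψ) ∧ ∀ t ∈ Icc (0 : ℝ) 1, ψ t = primitive (weakDerivUnit ψ) t := by
  obtain ⟨h2, hw⟩ := exists_weakDeriv_spec h.exists_weakDeriv
  refine ⟨h2, ?_⟩
  have hG := h2.hasWeakDerivUnit_primitive
  set G := primitive (weakDerivUnit ψ)
  have hGc : ContinuousOn G (Icc 0 1) := h2.primitive_continuousOn
  obtain ⟨k, hk⟩ := HasWeakDerivUnit.eqOn_const (ψ := fun t => ψ t - G t)
    (h.continuousOn.sub hGc) (fun η hη hc hs => by
      have hd : MemL2Unit (deriv η) := ((hη.continuous_deriv (by simp))).continuousOn.memL2Unit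
      have i1 : IntegrableOn (fun t => ψ t * deriv η t) (Ioo 0 1) :=
        MemLp.integrable_mul h.continuousOn.memL2Unit hd
      have i2 : IntegrableOn (fun t => G t * deriv η t) (Ioo 0 1) :=
        MemLp.integrable_mul hGc.memL2Unit hd
      simp only [sub_mul, Pi.zero_apply, zero_mul, integral_zero, neg_zero]
      rw [integral_sub i1 i2, hw η hη hc hs, hG η hη hc hs, sub_self])
  have k0 : k = 0 := by
    rw [← hk 0 zero_mem_unit, h.left]
    simp [G, primitive_zero]
  intro t ht
  have := hk t ht
  linarith

/-- Primitives of square-integrable functions belong to `H¹(0, 1)`. -/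
theorem MemL2Unit.memH1Bdry {g ψ : ℝ → ℝ} {c : ℝ} (hg : MemL2Unit g)
    (hψ : ∀ t ∈ Icc (0 : ℝ) 1, ψ t = primitive g t) (hc : primitive g 1 = c) :
    MemH1Bdry c ψ ∧ weakDerivUnit ψ =ᵐ[volume.restrict (Ioo (0 : ℝ) 1)] g := by
  have hcont : ContinuousOn ψ (Icc 0 1) := hg.primitive_continuousOn.congr hψ
  have hw : HasWeakDerivUnit ψ g := fun η hη hc hs => by
    rw [← hg.hasWeakDerivUnit_primitive η hη hc hs]
    exact setIntegral_congr_fun measurableSet_Ioo fun t ht => by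
      simp only [hψ t (Ioo_subset_Icc_self ht)]
  have hex : ∃ g : ℝ → ℝ, MemL2Unit g ∧ HasWeakDerivUnit ψ g := ⟨g, hg, hw⟩
  refine ⟨⟨hcont, hcont.memL2Unit, hex, ?_, ?_⟩, ?_⟩
  · rw [hψ 0 zero_mem_unit, primitive_zero]
  · rw [hψ 1 one_mem_unit, hc]
  · obtain ⟨h2, h3⟩ := exists_weakDeriv_spec hex
    exact h3.ae_eq hw h2 hg

/-! ### The energy in terms of the derivative of the deviation from `t * (1 - t)` -/

/-- The derivatives `h` of functions in `H₀¹(0, 1)`. -/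
structure Admissible (h : ℝ → ℝ) : Prop where
  memL2 : MemL2Unit h
  primitive_one : primitive h 1 = 0

/-- The function with boundary values zero whose deviation from `t * (1 - t)` has derivative `h`. -/
noncomputable def profile (h : ℝ → ℝ) (t : ℝ) : ℝ := t * (1 - t) + primitive h t

/-- The Dirichlet integral `∫₀¹ h²`. -/
noncomputable def dirichlet (h : ℝ → ℝ) : ℝ := ∫ t in (0 : ℝ)..1, h t ^ 2

/-- The integral of the potential along the profile of `h`. -/
noncomputable def bulk (χ : ℝ → ℝ) (l : ℝ) (h : ℝ → ℝ) : ℝ :=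
  ∫ t in (0 : ℝ)..1, potentialF χ l (profile h t)

/-- The excess of the energy of the profile of `h` over the energy `-1/6` of `t * (1 - t)`. -/
noncomputable def excess (χ : ℝ → ℝ) (l : ℝ) (h : ℝ → ℝ) : ℝ :=
  (1 / 2) * dirichlet h - bulk χ l h

variable {χ : ℝ → ℝ} {l : ℝ} {h : ℝ → ℝ}

theorem IsTruncation.contDiff_potentialF (hχ : IsTruncation χ) (l : ℝ) :
    ContDiff ℝ ∞ (potentialF χ l) :=
  (hχ.smooth.pow 3).sub (contDiff_const.mul (hχ.smooth.pow 4))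

theorem IsTruncation.contDiff_nonlinearity (hχ : IsTruncation χ) (l : ℝ) :
    ContDiff ℝ ∞ (nonlinearity χ l) :=
  contDiff_const.add (contDiff_infty_iff_deriv.1 (hχ.contDiff_potentialF l)).2

theorem IsTruncation.continuous_potentialF (hχ : IsTruncation χ) (l : ℝ) :
    Continuous (potentialF χ l) := (hχ.contDiff_potentialF l).continuous

theorem IsTruncation.potentialF_eq_zero (hχ : IsTruncation χ) (l : ℝ) {s : ℝ} (hs : s ≤ 1) :
    potentialF χ l s = 0 := by simp [potentialF, hχ.eq_zero s hs]

theorem IsTruncation.primitive_nonlinearity (hχ : IsTruncation χ) (l u : ℝ) :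
    primitive (nonlinearity χ l) u = 2 * u + potentialF χ l u := by
  have hF := hχ.contDiff_potentialF l
  have hd : Continuous (deriv (potentialF χ l)) := hF.continuous_deriv (by simp)
  have e : ∫ s in (0 : ℝ)..u, deriv (potentialF χ l) s = potentialF χ l u - potentialF χ l 0 :=
    intervalIntegral.integral_deriv_eq_sub
      (fun s _ => (hF.differentiable (by simp)).differentiableAt) (hd.intervalIntegrable _ _)
  unfold primitive nonlinearity
  rw [intervalIntegral.integral_add (by simp) (hd.intervalIntegrable _ _), e,
    hχ.potentialF_eq_zero l zero_le_one]
  simp; ring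

/-- With y = l χ(s), the function y³ - y⁴ has maximum 27/256 at y = 3/4; the difference factors as
(y - 3/4)² ((y + 1/4)² + 1/8). -/
theorem potentialF_le (hl : 0 < l) (χ : ℝ → ℝ) (s : ℝ) :
    potentialF χ l s ≤ 27 / (256 * l ^ 3) := by
  rw [le_div_iff₀ (by positivity), potentialF]
  have : 0 ≤ (l * χ s - 3 / 4) ^ 2 * ((l * χ s + 1 / 4) ^ 2 + 1 / 8) := by positivity
  nlinarith [this]

theorem MemL2Unit.profile_continuousOn (hh : MemL2Unit h) : ContinuousOn (profile h) (Icc 0 1) :=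
  ContinuousOn.add (by fun_prop) hh.primitive_continuousOn

theorem MemL2Unit.potentialF_profile_continuousOn (hh : MemL2Unit h) (hχ : IsTruncation χ)
    (l : ℝ) : ContinuousOn (fun t => potentialF χ l (profile h t)) (Icc 0 1) :=
  (hχ.continuous_potentialF l).comp_continuousOn hh.profile_continuousOn

theorem ContinuousOn.intervalIntegrable_unit {f : ℝ → ℝ} (hf : ContinuousOn f (Icc 0 1))
    {p q : ℝ} (hp : p ∈ Icc (0 : ℝ) 1) (hq : q ∈ Icc (0 : ℝ) 1) :
    IntervalIntegrable f volume p q :=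
  IntegrableOn.intervalIntegrable_of_mem_Icc hf.integrableOn_Ioo_unit hp hq

theorem integral_one_sub_two_mul (u : ℝ) : ∫ t in (0 : ℝ)..u, (1 - 2 * t) = u * (1 - u) := by
  rw [intervalIntegral.integral_sub (by simp)
    ((by fun_prop : Continuous fun t : ℝ => 2 * t).intervalIntegrable _ _),
    intervalIntegral.integral_const_mul, integral_id]
  simp; ring

/-- The energy of the profile of an admissible `h`. -/
theorem Admissible.energy_eq (hh : Admissible h) (hχ : IsTruncation χ) {ψ : ℝ → ℝ}
    (hψ : ∀ t ∈ Icc (0 : ℝ) 1, ψ t = profile h t) :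
    MemH1Bdry 0 ψ ∧ ∀ l, energy (nonlinearity χ l) ψ = -1 / 6 + excess χ l h := by
  have hk : ContinuousOn (fun t : ℝ => 1 - 2 * t) (Icc 0 1) := by fun_prop
  have hg : MemL2Unit (fun t => h t + (1 - 2 * t)) := hh.memL2.add hk.memL2Unit
  have hprim : ∀ t ∈ Icc (0 : ℝ) 1, primitive (fun t => h t + (1 - 2 * t)) t = profile h t := by
    intro t ht
    rw [primitive, intervalIntegral.integral_add (hh.memL2.intervalIntegrable zero_mem_unit ht)
      (hk.intervalIntegrable_unit zero_mem_unit ht), integral_one_sub_two_mul, profile, primitive]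
    ring
  obtain ⟨hm, hw⟩ := hg.memH1Bdry (c := 0) (fun t ht => (hψ t ht).trans (hprim t ht).symm)
    (by rw [hprim 1 one_mem_unit, profile, hh.primitive_one]; ring)
  refine ⟨hm, fun l => ?_⟩
  -- The three groups are the excess density, the terms linear in the deviation, and the energy
  -- density of t(1-t).
  have e1 : energy (nonlinearity χ l) ψ = ∫ t in (0 : ℝ)..1,
      ((1 / 2 * h t ^ 2 - potentialF χ l (profile h t)) +
        ((h t * (1 - 2 * t) - 2 * primitive h t) + (1 / 2 - 4 * t + 4 * t ^ 2))) := by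
    rw [energy, ← integral_Ioo_eq_interval]
    refine integral_congr_ae ?_
    filter_upwards [hw, ae_restrict_mem measurableSet_Ioo] with t ht htm
    rw [ht, hχ.primitive_nonlinearity, hψ t (Ioo_subset_Icc_self htm), profile]
    ring
  have i1 := (hh.memL2.intervalIntegrable_sq zero_mem_unit one_mem_unit).const_mul (1 / 2)
  have i2 := (hh.memL2.potentialF_profile_continuousOn hχ l).intervalIntegrable_unit
    zero_mem_unit one_mem_unit
  have i3 := hh.memL2.intervalIntegrable_mul hk.memL2Unit zero_mem_unit one_mem_unit
  have i4 := (hh.memL2.primitive_continuousOn.intervalIntegrable_unit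
    zero_mem_unit one_mem_unit).const_mul 2
  have i5 : IntervalIntegrable (fun t : ℝ => 1 / 2 - 4 * t + 4 * t ^ 2) volume 0 1 :=
    (by fun_prop : Continuous _).intervalIntegrable _ _
  have e2 : ∫ t in (0 : ℝ)..1, (1 / 2 - 4 * t + 4 * t ^ 2) = -1 / 6 := by
    rw [intervalIntegral.integral_add
      ((by fun_prop : Continuous fun t : ℝ => 1 / 2 - 4 * t).intervalIntegrable _ _)
      ((by fun_prop : Continuous fun t : ℝ => 4 * t ^ 2).intervalIntegrable _ _),
      intervalIntegral.integral_sub (by simp)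
      ((by fun_prop : Continuous fun t : ℝ => 4 * t).intervalIntegrable _ _),
      intervalIntegral.integral_const_mul, intervalIntegral.integral_const_mul, integral_id,
      integral_pow]
    norm_num
  -- Integration by parts against φ' = 1 - 2t, with φ'' = -2, cancels the linear group.
  have e3 := hh.memL2.integral_primitive_mul_deriv (k := fun t => 1 - 2 * t) (by fun_prop)
  have hdk : deriv (fun t : ℝ => 1 - 2 * t) = fun _ => -2 := by
    ext t
    simp
  rw [hdk, hh.primitive_one, zero_mul, intervalIntegral.integral_mul_const] at e3
  rw [e1, intervalIntegral.integral_add (i1.sub i2) ((i3.sub i4).add i5),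
    intervalIntegral.integral_add (i3.sub i4) i5, intervalIntegral.integral_sub i1 i2,
    intervalIntegral.integral_sub i3 i4, e2, intervalIntegral.integral_const_mul,
    intervalIntegral.integral_const_mul, excess, dirichlet, bulk]
  linarith

/-- Every element of `H₀¹(0, 1)` is the profile of an admissible function. -/
theorem MemH1Bdry.exists_admissible {ψ : ℝ → ℝ} (hψ : MemH1Bdry 0 ψ) :
    ∃ h, Admissible h ∧ ∀ t ∈ Icc (0 : ℝ) 1, ψ t = profile h t := by
  obtain ⟨hg, hp⟩ := hψ.eq_primitive
  have hk : ContinuousOn (fun t : ℝ => 1 - 2 * t) (Icc 0 1) := by fun_prop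
  have hprim : ∀ t ∈ Icc (0 : ℝ) 1, primitive (fun t => weakDerivUnit ψ t - (1 - 2 * t)) t
      = ψ t - t * (1 - t) := by
    intro t ht
    rw [primitive, intervalIntegral.integral_sub (hg.intervalIntegrable zero_mem_unit ht)
      (hk.intervalIntegrable_unit zero_mem_unit ht), integral_one_sub_two_mul, hp t ht, primitive]
  refine ⟨fun t => weakDerivUnit ψ t - (1 - 2 * t), ⟨hg.sub hk.memL2Unit, ?_⟩, fun t ht => ?_⟩
  · rw [hprim 1 one_mem_unit, hψ.right]; ring
  · rw [profile, hprim t ht]; ring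

theorem mem_lowEnergySet_iff (hχ : IsTruncation χ) :
    l ∈ lowEnergySet χ ↔ 0 < l ∧ ∃ h, Admissible h ∧ excess χ l h < 0 := by
  simp only [lowEnergySet, mem_ofPred_eq, minEnergy, iInf_lt_iff, EReal.coe_lt_coe_iff]
  refine and_congr_right fun _ => ⟨?_, ?_⟩
  · rintro ⟨⟨ψ, hψ⟩, he⟩
    obtain ⟨h, hh, hp⟩ := hψ.exists_admissible
    rw [(hh.energy_eq hχ hp).2] at he
    exact ⟨h, hh, by linarith⟩
  · rintro ⟨h, hh, he⟩
    have := hh.energy_eq hχ (ψ := profile h) (fun _ _ => rfl)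
    exact ⟨⟨_, this.1⟩, by rw [this.2]; linarith⟩

/-! ### Elementary bounds -/

theorem MemL2Unit.integral_sub_const_sq (hh : MemL2Unit h) {p q : ℝ} (hp : p ∈ Icc (0 : ℝ) 1)
    (hq : q ∈ Icc (0 : ℝ) 1) (m : ℝ) :
    ∫ t in p..q, (h t - m) ^ 2
      = (∫ t in p..q, h t ^ 2) - 2 * m * (∫ t in p..q, h t) + m ^ 2 * (q - p) := by
  have i1 := hh.intervalIntegrable_sq hp hq
  have i2 := (hh.intervalIntegrable hp hq).const_mul (2 * m)
  rw [← intervalIntegral.integral_const_mul]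
  have : ∫ t in p..q, m ^ 2 = m ^ 2 * (q - p) := by simp; ring
  rw [← this, ← intervalIntegral.integral_sub i1 i2,
    ← intervalIntegral.integral_add (i1.sub i2) (by simp)]
  congr 1; ext t; ring

/-- Cauchy–Schwarz, obtained from the nonnegativity of the variance of h on [p, q]. -/
theorem MemL2Unit.sq_integral_le (hh : MemL2Unit h) {p q : ℝ} (hp : p ∈ Icc (0 : ℝ) 1)
    (hq : q ∈ Icc (0 : ℝ) 1) (hpq : p ≤ q) :
    (∫ t in p..q, h t) ^ 2 ≤ (q - p) * ∫ t in p..q, h t ^ 2 := by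
  rcases hpq.eq_or_lt with rfl | hlt
  · simp
  have hd : 0 < q - p := sub_pos.2 hlt
  have h0 : 0 ≤ ∫ t in p..q, (h t - (∫ t in p..q, h t) / (q - p)) ^ 2 :=
    intervalIntegral.integral_nonneg hpq fun t _ => sq_nonneg _
  rw [hh.integral_sub_const_sq hp hq] at h0
  set A := ∫ t in p..q, h t
  have : (∫ t in p..q, h t ^ 2) - 2 * (A / (q - p)) * A + (A / (q - p)) ^ 2 * (q - p)
      = (∫ t in p..q, h t ^ 2) - A ^ 2 / (q - p) := by field_simp; ring
  rw [this, sub_nonneg, div_le_iff₀ hd] at h0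
  linarith

theorem MemL2Unit.dirichlet_split (hh : MemL2Unit h) {p : ℝ} (hp : p ∈ Icc (0 : ℝ) 1) :
    (∫ t in (0 : ℝ)..p, h t ^ 2) + ∫ t in p..1, h t ^ 2 = dirichlet h :=
  intervalIntegral.integral_add_adjacent_intervals
    (hh.intervalIntegrable_sq zero_mem_unit hp) (hh.intervalIntegrable_sq hp one_mem_unit)

theorem dirichlet_nonneg (h : ℝ → ℝ) : 0 ≤ dirichlet h :=
  intervalIntegral.integral_nonneg zero_le_one fun _ _ => sq_nonneg _

theorem MemL2Unit.sq_primitive_le (hh : MemL2Unit h) {t : ℝ} (ht : t ∈ Icc (0 : ℝ) 1) :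
    primitive h t ^ 2 ≤ dirichlet h := by
  have h1 := hh.sq_integral_le zero_mem_unit ht ht.1
  have h2 : 0 ≤ ∫ s in t..1, h s ^ 2 :=
    intervalIntegral.integral_nonneg ht.2 fun _ _ => sq_nonneg _
  have h3 : 0 ≤ ∫ s in (0 : ℝ)..t, h s ^ 2 :=
    intervalIntegral.integral_nonneg ht.1 fun _ _ => sq_nonneg _
  have h4 := hh.dirichlet_split ht
  have h5 : (t - 0) * ∫ s in (0 : ℝ)..t, h s ^ 2 ≤ 1 * ∫ s in (0 : ℝ)..t, h s ^ 2 :=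
    mul_le_mul_of_nonneg_right (by linarith [ht.2]) h3
  rw [primitive]; linarith

/-- The activation threshold 3/4 is 1 minus the maximum 1/4 of t(1-t). -/
theorem profile_le_one {t : ℝ} (hw : primitive h t ≤ 3 / 4) : profile h t ≤ 1 := by
  rw [profile]; nlinarith [sq_nonneg (t - 1 / 2)]

theorem bulk_eq_zero (hχ : IsTruncation χ) (hw : ∀ t ∈ Icc (0 : ℝ) 1, primitive h t ≤ 3 / 4) :
    bulk χ l h = 0 := by
  rw [bulk, intervalIntegral.integral_congr (g := fun _ => 0), intervalIntegral.integral_zero]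
  intro t ht
  rw [uIcc_of_le zero_le_one] at ht
  exact hχ.potentialF_eq_zero l (profile_le_one (hw t ht))

/-- The gap that keeps nontrivial competitors from degenerating in a limit: below (3/4)²,
`MemL2Unit.sq_primitive_le` keeps the deviation under the threshold. -/
theorem MemL2Unit.dirichlet_ge (hh : MemL2Unit h) (hχ : IsTruncation χ) (hb : bulk χ l h ≠ 0) :
    9 / 16 ≤ dirichlet h := by
  by_contra hlt
  refine hb (bulk_eq_zero hχ fun t ht => ?_)
  have := hh.sq_primitive_le ht
  nlinarith

theorem MemL2Unit.bulk_le (hh : MemL2Unit h) (hχ : IsTruncation χ) (hl : 0 < l) :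
    bulk χ l h ≤ 27 / (256 * l ^ 3) := by
  have := intervalIntegral.integral_mono_on zero_le_one
    ((hh.potentialF_profile_continuousOn hχ l).intervalIntegrable_unit zero_mem_unit one_mem_unit)
    (by simp) (g := fun _ => 27 / (256 * l ^ 3)) fun t _ => potentialF_le hl χ (profile h t)
  simpa [bulk] using this

/-! ### Existence of truncations, and the set of low-energy parameters -/

theorem exists_isTruncation : ∃ χ : ℝ → ℝ, IsTruncation χ := by
  -- For s > 1 this is (s - 1) exp(-1/(s - 1)); the lower bound s - 2 is the inequality exp x ≥ 1 +
  -- x.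
  refine ⟨fun s => (s - 1) * expNegInvGlue (s - 1), ?_, ?_, ?_, ?_, ?_, ?_⟩
  · exact (contDiff_id.sub contDiff_const).mul
      (expNegInvGlue.contDiff.comp (contDiff_id.sub contDiff_const))
  · intro s
    rcases le_total s 1 with hs | hs
    · simp [expNegInvGlue.zero_of_nonpos (sub_nonpos.2 hs)]
    · exact mul_nonneg (sub_nonneg.2 hs) (expNegInvGlue.nonneg _)
  · intro s hs
    simp [expNegInvGlue.zero_of_nonpos (sub_nonpos.2 hs)]
  · intro s hs
    have h1 : expNegInvGlue (s - 1) ≤ 1 := by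
      unfold expNegInvGlue
      split_ifs
      · exact zero_le_one
      · exact Real.exp_le_one_iff.2 (by simpa using hs)
    exact mul_le_of_le_one_right (sub_nonneg.2 hs) h1
  · intro s hs
    rcases hs.eq_or_lt with rfl | hs
    · norm_num
    · have hv : 0 < s - 1 := sub_pos.2 hs
      have e : expNegInvGlue (s - 1) = Real.exp (-(s - 1)⁻¹) := by
        simp [expNegInvGlue, not_le.2 hv]
      have := Real.add_one_le_exp (-(s - 1)⁻¹)
      have h2 := mul_le_mul_of_nonneg_left this hv.le
      have h3 : (s - 1) * (-(s - 1)⁻¹ + 1) = s - 2 := by field_simp; ring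
      rw [e]; linarith
  · intro s hs
    have hv : 0 < s - 1 := sub_pos.2 hs
    have he : (fun s => (s - 1) * expNegInvGlue (s - 1))
        =ᶠ[nhds s] fun s => (s - 1) * Real.exp (-(s - 1)⁻¹) := by
      filter_upwards [Ioi_mem_nhds hs] with r hr
      have : ¬ r - 1 ≤ 0 := not_le.2 (sub_pos.2 hr)
      simp [expNegInvGlue, this]
    have h1 : HasDerivAt (fun s : ℝ => s - 1) 1 s := (hasDerivAt_id s).sub_const 1
    have hd := h1.mul ((h1.inv hv.ne').neg.exp)
    rw [he.deriv_eq, show (fun s : ℝ => (s - 1) * Real.exp (-(s - 1)⁻¹)) =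
      (fun s => s - 1) * (fun s => Real.exp ((-(fun s : ℝ => s - 1)⁻¹) s)) from rfl, hd.deriv]
    simp only [Pi.neg_apply, Pi.inv_apply]
    have := Real.exp_pos (-(s - 1)⁻¹)
    have h4 : 0 < 1 / (s - 1) ^ 2 := by positivity
    have h5 : 0 < Real.exp (-(s - 1)⁻¹) * -(-1 / (s - 1) ^ 2) := by
      rw [neg_div, neg_neg]; positivity
    nlinarith [mul_pos hv h5]

theorem lowEnergySet_nonempty (hχ : IsTruncation χ) : (lowEnergySet χ).Nonempty := by
  have hc : ContinuousOn (fun t : ℝ => 127 * (1 - 2 * t)) (Icc 0 1) := by fun_prop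
  have hpar : ∀ u : ℝ, primitive (fun t => 127 * (1 - 2 * t)) u = 127 * (u * (1 - u)) := fun u => by
    rw [primitive, intervalIntegral.integral_const_mul, integral_one_sub_two_mul]
  have hprof : ∀ t, profile (fun t => 127 * (1 - 2 * t)) t = 128 * (t * (1 - t)) := fun t => by
    rw [profile, hpar]; ring
  have hmem := hc.memL2Unit
  -- The competitor is 128 t(1-t), with maximum 32. There χ ≤ 31, so l χ ≤ 1/10 and F_l ≥ (9/10) χ³.
  -- On [1/4, 3/4] the profile is at least 24, so χ ≥ 22 and F_l ≥ 8000; the potential term is at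
  -- least 4000, against a Dirichlet cost 127²/6 < 2700.
  refine ⟨1 / 1000, (mem_lowEnergySet_iff hχ).2 ⟨by norm_num, fun t => 127 * (1 - 2 * t),
    ⟨hmem, by rw [hpar]; ring⟩, ?_⟩⟩
  have hD : dirichlet (fun t => 127 * (1 - 2 * t)) = 127 ^ 2 / 3 := by
    have : ∀ t : ℝ, (127 * (1 - 2 * t)) ^ 2 = 127 ^ 2 - 127 ^ 2 * 4 * t + 127 ^ 2 * 4 * t ^ 2 :=
      fun t => by ring
    simp only [dirichlet, this]
    rw [intervalIntegral.integral_add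
      ((by fun_prop : Continuous fun t : ℝ => 127 ^ 2 - 127 ^ 2 * 4 * t).intervalIntegrable _ _)
      ((by fun_prop : Continuous fun t : ℝ => 127 ^ 2 * 4 * t ^ 2).intervalIntegrable _ _),
      intervalIntegral.integral_sub (by simp)
      ((by fun_prop : Continuous fun t : ℝ => 127 ^ 2 * 4 * t).intervalIntegrable _ _),
      intervalIntegral.integral_const_mul, intervalIntegral.integral_const_mul, integral_id,
      integral_pow]
    norm_num
  have hle : ∀ t : ℝ, χ (128 * (t * (1 - t))) ≤ 31 := fun t => by
    rcases le_total (128 * (t * (1 - t))) 1 with h1 | h1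
    · rw [hχ.eq_zero _ h1]; norm_num
    · have := hχ.le_sub_one _ h1
      nlinarith [sq_nonneg (t - 1 / 2)]
  have hF : ∀ t : ℝ, 9 / 10 * χ (128 * (t * (1 - t))) ^ 3
      ≤ potentialF χ (1 / 1000) (128 * (t * (1 - t))) := fun t => by
    have h0 := pow_nonneg (hχ.nonneg (128 * (t * (1 - t)))) 3
    have := mul_le_mul_of_nonneg_left (hle t) h0
    rw [potentialF]
    nlinarith
  have hii : ∀ {p q : ℝ}, p ∈ Icc (0 : ℝ) 1 → q ∈ Icc (0 : ℝ) 1 → IntervalIntegrable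
      (fun t => potentialF χ (1 / 1000) (profile (fun t => 127 * (1 - 2 * t)) t)) volume p q :=
    fun hp hq => (hmem.potentialF_profile_continuousOn hχ _).intervalIntegrable_unit hp hq
  have hB : 4000 ≤ bulk χ (1 / 1000) (fun t => 127 * (1 - 2 * t)) := by
    have h1 : ∫ t in (1 / 4 : ℝ)..(3 / 4),
        potentialF χ (1 / 1000) (profile (fun t => 127 * (1 - 2 * t)) t)
        ≤ bulk χ (1 / 1000) (fun t => 127 * (1 - 2 * t)) := by
      refine intervalIntegral.integral_mono_interval (by norm_num) (by norm_num) (by norm_num)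
        (Filter.Eventually.of_forall fun t => ?_) (hii zero_mem_unit one_mem_unit)
      rw [Pi.zero_apply]
      beta_reduce
      rw [hprof]
      exact (mul_nonneg (by norm_num) (pow_nonneg (hχ.nonneg _) 3)).trans (hF t)
    have h2 := intervalIntegral.integral_mono_on (a := (1 / 4 : ℝ)) (b := 3 / 4)
      (f := fun _ => (8000 : ℝ)) (by norm_num) (by simp)
      (hii (p := 1 / 4) (q := 3 / 4) (by norm_num) (by norm_num)) fun t ht => by
        rw [hprof]
        refine le_trans ?_ (hF t)
        have h3 : 24 ≤ 128 * (t * (1 - t)) := by nlinarith [ht.1, ht.2]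
        have h4 : 22 ≤ χ (128 * (t * (1 - t))) := by
          linarith [hχ.sub_two_le _ (by linarith : (1 : ℝ) ≤ 128 * (t * (1 - t)))]
        have h5 := pow_le_pow_left₀ (by norm_num) h4 3
        norm_num at h5
        linarith
    have h3 : ∫ _ in (1 / 4 : ℝ)..(3 / 4), (8000 : ℝ) = 4000 := by
      rw [intervalIntegral.integral_const]; norm_num
    rw [h3] at h2
    exact h2.trans h1
  rw [excess, hD]
  norm_num
  linarith

/-- For l ≥ 1 the potential term is at most 27/256, less than the least cost 9/32 of making it
nonzero. -/
theorem Admissible.excess_nonneg_of_one_le (hh : Admissible h) (hχ : IsTruncation χ)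
    (hl : 1 ≤ l) : 0 ≤ excess χ l h := by
  rw [excess]
  by_cases hb : bulk χ l h = 0
  · rw [hb]; linarith [dirichlet_nonneg h]
  · have h1 := hh.memL2.dirichlet_ge hχ hb
    have h2 := hh.memL2.bulk_le hχ (by linarith : 0 < l)
    have h3 : 27 / (256 * l ^ 3) ≤ 27 / 256 := by
      have : 1 ≤ l ^ 3 := one_le_pow₀ hl
      rw [div_le_div_iff₀ (by positivity) (by norm_num)]
      linarith
    linarith

theorem lowEnergySet_bddAbove (hχ : IsTruncation χ) : BddAbove (lowEnergySet χ) := by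
  refine ⟨1, fun l hl => ?_⟩
  obtain ⟨_, h, hh, he⟩ := (mem_lowEnergySet_iff hχ).1 hl
  by_contra hlt
  exact absurd (hh.excess_nonneg_of_one_le hχ (not_le.1 hlt).le) (not_le.2 he)

theorem criticalParam_pos (hχ : IsTruncation χ) : 0 < criticalParam χ := by
  obtain ⟨l, hl⟩ := lowEnergySet_nonempty hχ
  exact hl.1.trans_le (le_csSup (lowEnergySet_bddAbove hχ) hl)

/-! ### Weak compactness -/

theorem dirichlet_congr_ae {g k : ℝ → ℝ} (e : g =ᵐ[volume.restrict (Ioo (0 : ℝ) 1)] k) :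
    dirichlet g = dirichlet k := by
  rw [dirichlet, dirichlet, ← integral_Ioo_eq_interval, ← integral_Ioo_eq_interval]
  refine integral_congr_ae ?_
  filter_upwards [e] with t ht
  rw [ht]

theorem primitive_eq_setIntegral_restrict (g : ℝ → ℝ) {t : ℝ} (ht : t ∈ Icc (0 : ℝ) 1) :
    ∫ s in Ioo 0 t, g s ∂(volume.restrict (Ioo (0 : ℝ) 1)) = primitive g t := by
  rw [Measure.restrict_restrict measurableSet_Ioo,
    inter_eq_left.2 (Ioo_subset_Ioo_right ht.2), primitive,
    intervalIntegral.integral_of_le ht.1, integral_Ioc_eq_integral_Ioo]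

theorem primitive_congr_ae {g k : ℝ → ℝ} (e : g =ᵐ[volume.restrict (Ioo (0 : ℝ) 1)] k) {t : ℝ}
    (ht : t ∈ Icc (0 : ℝ) 1) : primitive g t = primitive k t := by
  rw [← primitive_eq_setIntegral_restrict g ht, ← primitive_eq_setIntegral_restrict k ht]
  exact integral_congr_ae (ae_restrict_of_ae e)

theorem norm_sq_eq_dirichlet (x : Lp ℝ 2 (volume.restrict (Ioo (0 : ℝ) 1))) :
    ‖x‖ ^ 2 = dirichlet x := by
  rw [← real_inner_self_eq_norm_sq, L2.inner_def, dirichlet, ← integral_Ioo_eq_interval]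
  congr 1; ext t
  simp [sq]

theorem norm_toLp_sq {g : ℝ → ℝ} (hg : MemL2Unit g) :
    ‖MemLp.toLp g hg‖ ^ 2 = dirichlet g := by
  rw [norm_sq_eq_dirichlet, dirichlet_congr_ae hg.coeFn_toLp]

/-- A sequence with bounded Dirichlet integrals has a subsequence whose primitives converge
pointwise to the primitive of some `g`; the Dirichlet integral is lower semicontinuous. -/
theorem exists_weak_limit {H : ℕ → ℝ → ℝ} (hH : ∀ n, MemL2Unit (H n)) {K : ℝ}
    (hK : ∀ n, dirichlet (H n) ≤ K) :
    ∃ g, MemL2Unit g ∧ ∃ σ : ℕ → ℕ, StrictMono σ ∧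
      (∀ t ∈ Icc (0 : ℝ) 1, Filter.Tendsto (fun n => primitive (H (σ n)) t) Filter.atTop
        (nhds (primitive g t))) ∧
      ∀ (b : ℕ → ℝ) (c : ℝ), (∀ n, dirichlet (H (σ n)) ≤ b n) →
        Filter.Tendsto b Filter.atTop (nhds c) → dirichlet g ≤ c := by
  have : Fact ((2 : ENNReal) ≠ ⊤) := ⟨by norm_num⟩
  let E := Lp ℝ 2 (volume.restrict (Ioo (0 : ℝ) 1))
  let x : ℕ → E := fun n => (hH n).toLp
  -- Riesz representation turns bounded sequences in L² into bounded sequences of functionals, to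
  -- which sequential Banach–Alaoglu applies.
  let y : ℕ → WeakDual ℝ E := fun n => StrongDual.toWeakDual (InnerProductSpace.toDual ℝ E (x n))
  have hy : ∀ n, y n ∈ WeakDual.toStrongDual ⁻¹'
      Metric.closedBall (0 : StrongDual ℝ E) (Real.sqrt K) := by
    intro n
    rw [mem_preimage, mem_closedBall_zero_iff]
    change ‖InnerProductSpace.toDual ℝ E (x n)‖ ≤ _
    rw [LinearIsometryEquiv.norm_map]
    apply Real.le_sqrt_of_sq_le
    rw [norm_toLp_sq (hH n)]
    exact hK n
  obtain ⟨φ, -, σ, hσ, hlim⟩ := WeakDual.isSeqCompact_closedBall ℝ E 0 (Real.sqrt K) hy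
  let z : E := (InnerProductSpace.toDual ℝ E).symm (WeakDual.toStrongDual φ)
  have hz : ∀ v : E, φ v = inner ℝ z v := fun v =>
    (InnerProductSpace.toDual_symm_apply (x := v) (y := WeakDual.toStrongDual φ)).symm
  have hin : ∀ v : E, Filter.Tendsto (fun n => inner ℝ (x (σ n)) v) Filter.atTop
      (nhds (inner ℝ z v)) := by
    intro v
    have := ((WeakDual.eval_continuous v).tendsto φ).comp hlim
    rw [hz] at this
    exact this
  refine ⟨z, Lp.memLp z, σ, hσ, fun t ht => ?_, fun b c hb hc => ?_⟩
  -- Pairing with the indicator of (0, t) evaluates the primitive at t.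
  · have hfin : volume.restrict (Ioo (0 : ℝ) 1) (Ioo 0 t) ≠ ⊤ := measure_ne_top _ _
    have hev : ∀ w : E, inner ℝ w (indicatorConstLp 2 measurableSet_Ioo hfin (1 : ℝ))
        = primitive w t := fun w => by
      rw [real_inner_comm, L2.inner_indicatorConstLp_one, primitive_eq_setIntegral_restrict _ ht]
    have := hin (indicatorConstLp 2 measurableSet_Ioo hfin (1 : ℝ))
    rw [hev] at this
    refine this.congr fun n => ?_
    rw [hev, primitive_congr_ae (hH (σ n)).coeFn_toLp ht]
  -- Lower semicontinuity: pass to the limit in 2⟨x, z⟩ ≤ ‖x‖² + ‖z‖².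
  · have h1 : ∀ n, 2 * inner ℝ (x (σ n)) z ≤ b n + ‖z‖ ^ 2 := fun n => by
      have h2 := norm_sub_sq_real (x (σ n)) z
      have h3 := norm_toLp_sq (hH (σ n))
      have h4 := hb n
      change ‖x (σ n)‖ ^ 2 = _ at h3
      nlinarith [sq_nonneg ‖x (σ n) - z‖]
    have h2 := le_of_tendsto_of_tendsto' ((hin z).const_mul 2) (hc.add_const (‖z‖ ^ 2)) h1
    rw [real_inner_self_eq_norm_sq] at h2
    rw [← norm_sq_eq_dirichlet]
    linarith

/-- A crude bound without square roots; it only serves as a dominating constant. -/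
theorem abs_primitive_le {H : ℝ → ℝ} (hH : MemL2Unit H) {K : ℝ} (hK : dirichlet H ≤ K)
    {t : ℝ} (ht : t ∈ Icc (0 : ℝ) 1) : |primitive H t| ≤ 1 + K := by
  have h1 := hH.sq_primitive_le ht
  rw [abs_le]
  constructor <;> nlinarith [sq_nonneg (primitive H t + 1 / 2), sq_nonneg (primitive H t - 1 / 2)]

theorem IsTruncation.le_abs (hχ : IsTruncation χ) (s : ℝ) : χ s ≤ |s| := by
  rcases le_total s 1 with hs | hs
  · rw [hχ.eq_zero s hs]; exact abs_nonneg s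
  · linarith [hχ.le_sub_one s hs, le_abs_self s]

theorem abs_profile_le {H : ℝ → ℝ} (hH : MemL2Unit H) {K : ℝ} (hK : dirichlet H ≤ K)
    {t : ℝ} (ht : t ∈ Icc (0 : ℝ) 1) : |profile H t| ≤ 2 + K := by
  have h1 := abs_le.1 (abs_primitive_le hH hK ht)
  have h2 := mul_nonneg ht.1 (sub_nonneg.2 ht.2)
  rw [profile, abs_le]
  constructor <;> nlinarith [sq_nonneg (t - 1 / 2)]

theorem tendsto_integral_primitive {H : ℕ → ℝ → ℝ} (hH : ∀ n, MemL2Unit (H n)) {K : ℝ}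
    (hK : ∀ n, dirichlet (H n) ≤ K) {g : ℝ → ℝ}
    (hg : ∀ t ∈ Icc (0 : ℝ) 1, Filter.Tendsto (fun n => primitive (H n) t) Filter.atTop
        (nhds (primitive g t))) :
    Filter.Tendsto (fun n => ∫ t in (0 : ℝ)..1, primitive (H n) t) Filter.atTop
      (nhds (∫ t in (0 : ℝ)..1, primitive g t)) := by
  have hsub : ∀ {t : ℝ}, t ∈ uIoc (0 : ℝ) 1 → t ∈ Icc (0 : ℝ) 1 := fun ht => by
    rw [uIoc_of_le zero_le_one] at ht; exact Ioc_subset_Icc_self ht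
  refine intervalIntegral.tendsto_integral_filter_of_dominated_convergence (fun _ => 1 + K)
    (Filter.Eventually.of_forall fun n => ?_)
    (Filter.Eventually.of_forall fun n => Filter.Eventually.of_forall fun t ht =>
      abs_primitive_le (hH n) (hK n) (hsub ht)) (by simp)
    (Filter.Eventually.of_forall fun t ht => hg t (hsub ht))
  exact ((hH n).primitive_continuousOn.intervalIntegrable_unit zero_mem_unit
    one_mem_unit).def'.aestronglyMeasurable

/-- Dominated convergence, with the parameter allowed to vary along the sequence. -/
theorem tendsto_bulk (hχ : IsTruncation χ) {H : ℕ → ℝ → ℝ} (hH : ∀ n, MemL2Unit (H n)) {K : ℝ}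
    (hK : ∀ n, dirichlet (H n) ≤ K) {g : ℝ → ℝ}
    (hg : ∀ t ∈ Icc (0 : ℝ) 1, Filter.Tendsto (fun n => primitive (H n) t) Filter.atTop
        (nhds (primitive g t)))
    {u : ℕ → ℝ} (hu : Filter.Tendsto u Filter.atTop (nhds l)) :
    Filter.Tendsto (fun n => bulk χ (u n) (H n)) Filter.atTop (nhds (bulk χ l g)) := by
  have hsub : ∀ {t : ℝ}, t ∈ uIoc (0 : ℝ) 1 → t ∈ Icc (0 : ℝ) 1 := fun ht => by
    rw [uIoc_of_le zero_le_one] at ht; exact Ioc_subset_Icc_self ht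
  obtain ⟨L, hL⟩ := hu.norm.bddAbove_range
  have hL' : ∀ n, |u n| ≤ L := fun n => hL ⟨n, rfl⟩
  refine intervalIntegral.tendsto_integral_filter_of_dominated_convergence
    (fun _ => (2 + K) ^ 3 + L * (2 + K) ^ 4)
    (Filter.Eventually.of_forall fun n => ?_)
    (Filter.Eventually.of_forall fun n => Filter.Eventually.of_forall fun t ht => ?_) (by simp)
    (Filter.Eventually.of_forall fun t ht => ?_)
  · exact (((hH n).potentialF_profile_continuousOn hχ (u n)).intervalIntegrable_unit zero_mem_unit
      one_mem_unit).def'.aestronglyMeasurable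
  · have h0 := hχ.nonneg (profile (H n) t)
    have h1 : χ (profile (H n) t) ≤ 2 + K :=
      (hχ.le_abs _).trans (abs_profile_le (hH n) (hK n) (hsub ht))
    have hLn : 0 ≤ L := (abs_nonneg _).trans (hL' n)
    rw [Real.norm_eq_abs, potentialF]
    refine (abs_sub _ _).trans (add_le_add ?_ ?_)
    · rw [abs_of_nonneg (pow_nonneg h0 3)]
      exact pow_le_pow_left₀ h0 h1 3
    · rw [abs_mul, abs_of_nonneg (pow_nonneg h0 4)]
      exact mul_le_mul (hL' n) (pow_le_pow_left₀ h0 h1 4) (pow_nonneg h0 4) hLn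
  · have h1 : Filter.Tendsto (fun n => χ (profile (H n) t)) Filter.atTop
        (nhds (χ (profile g t))) :=
      (hχ.smooth.continuous.tendsto _).comp ((hg t (hsub ht)).const_add _)
    exact (h1.pow 3).sub (hu.mul (h1.pow 4))

/-- Limits of functions of nonpositive excess with nonzero bulk. -/
theorem exists_limit_excess_nonpos (hχ : IsTruncation χ) {H : ℕ → ℝ → ℝ}
    (hH : ∀ n, Admissible (H n)) {u : ℕ → ℝ} (hu : Filter.Tendsto u Filter.atTop (nhds l))
    {m : ℝ} (hm : 0 < m) (hmu : ∀ n, m ≤ u n)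
    (he : ∀ n, excess χ (u n) (H n) ≤ 0) (hb : ∀ n, bulk χ (u n) (H n) ≠ 0) :
    ∃ g, Admissible g ∧ excess χ l g ≤ 0 ∧ bulk χ l g ≠ 0 ∧ ∃ σ : ℕ → ℕ, StrictMono σ ∧
      Filter.Tendsto (fun n => ∫ t in (0 : ℝ)..1, primitive (H (σ n)) t) Filter.atTop
        (nhds (∫ t in (0 : ℝ)..1, primitive g t)) := by
  have hK : ∀ n, dirichlet (H n) ≤ 2 * (27 / (256 * m ^ 3)) := fun n => by
    have h1 := he n
    have h2 := (hH n).memL2.bulk_le hχ (hm.trans_le (hmu n))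
    have h3 : 27 / (256 * u n ^ 3) ≤ 27 / (256 * m ^ 3) := by
      have := pow_le_pow_left₀ hm.le (hmu n) 3
      exact div_le_div_of_nonneg_left (by norm_num) (by positivity) (by linarith)
    rw [excess] at h1
    linarith
  obtain ⟨g, hg, σ, hσ, hconv, hlsc⟩ := exists_weak_limit (fun n => (hH n).memL2) hK
  have hbulk := tendsto_bulk hχ (fun n => (hH (σ n)).memL2) (fun n => hK (σ n)) hconv
    (hu.comp hσ.tendsto_atTop)
  have hd : dirichlet g ≤ 2 * bulk χ l g := by
    -- Nonpositive excess bounds the Dirichlet integrals by twice the potential terms, and these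
    -- converge.
    refine hlsc _ _ (fun n => ?_) (hbulk.const_mul 2)
    have := he (σ n)
    rw [excess] at this
    simp only [Function.comp_apply]
    linarith
  -- Half of the gap 9/16 survives in the limit, so the limit is nontrivial.
  have hpos : 9 / 32 ≤ bulk χ l g := by
    refine ge_of_tendsto' hbulk fun n => ?_
    have h1 := (hH (σ n)).memL2.dirichlet_ge hχ (hb (σ n))
    have h2 := he (σ n)
    rw [excess] at h2
    simp only [Function.comp_apply]
    linarith
  refine ⟨g, ⟨hg, ?_⟩, by rw [excess]; linarith, by linarith [hpos] |> ne_of_gt, σ, hσ,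
    tendsto_integral_primitive (fun n => (hH (σ n)).memL2) (fun n => hK (σ n)) hconv⟩
  refine tendsto_nhds_unique (hconv 1 one_mem_unit) ?_
  simp only [(hH _).primitive_one]
  exact tendsto_const_nhds

/-! ### Minimizers at the critical parameter -/

/-- A negative excess would persist at a slightly larger parameter, by continuity in l,
contradicting the supremum. -/
theorem Admissible.excess_nonneg (hh : Admissible h) (hχ : IsTruncation χ) :
    0 ≤ excess χ (criticalParam χ) h := by
  by_contra hlt
  rw [not_le] at hlt
  have hb : Filter.Tendsto (fun n : ℕ => bulk χ (criticalParam χ + 1 / ((n : ℝ) + 1)) h)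
      Filter.atTop (nhds (bulk χ (criticalParam χ) h)) :=
    tendsto_bulk hχ (H := fun _ => h) (fun _ => hh.memL2) (fun _ => le_rfl)
      (fun _ _ => tendsto_const_nhds)
      (by simpa using tendsto_one_div_add_atTop_nhds_zero_nat.const_add (criticalParam χ))
  have he := (hb.const_sub ((1 / 2) * dirichlet h)).eventually_lt_const hlt
  obtain ⟨n, hn⟩ := he.exists
  have hp : (0 : ℝ) < 1 / ((n : ℝ) + 1) := by positivity
  have := le_csSup (lowEnergySet_bddAbove hχ) ((mem_lowEnergySet_iff hχ).2
    ⟨add_pos (criticalParam_pos hχ) hp, h, hh, hn⟩)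
  change _ ≤ criticalParam χ at this
  linarith

/-- `h` is the derivative of the deviation of a minimizer at the critical parameter. -/
structure IsCritical (χ : ℝ → ℝ) (h : ℝ → ℝ) : Prop extends Admissible h where
  excess_eq : excess χ (criticalParam χ) h = 0

theorem Admissible.isCritical (hh : Admissible h) (hχ : IsTruncation χ)
    (he : excess χ (criticalParam χ) h ≤ 0) : IsCritical χ h :=
  ⟨hh, le_antisymm he (hh.excess_nonneg hχ)⟩

theorem exists_isCritical (hχ : IsTruncation χ) :
    ∃ h, IsCritical χ h ∧ bulk χ (criticalParam χ) h ≠ 0 := by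
  obtain ⟨u, hmono, hu, hmem⟩ :=
    exists_seq_tendsto_sSup (lowEnergySet_nonempty hχ) (lowEnergySet_bddAbove hχ)
  have hmem' := fun n => (mem_lowEnergySet_iff hχ).1 (hmem n)
  choose hpos H hH he using hmem'
  -- Negative excess rules out a zero potential term, since the Dirichlet integral is nonnegative;
  -- monotonicity of the parameters gives the positive lower bound u 0.
  obtain ⟨g, hg, heg, hb, -⟩ := exists_limit_excess_nonpos hχ hH (l := criticalParam χ) hu
    (hpos 0) (fun n => hmono (Nat.zero_le n)) (fun n => (he n).le) (fun n h0 => by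
      have := he n
      rw [excess, h0] at this
      linarith [dirichlet_nonneg (H n)])
  exact ⟨g, hg.isCritical hχ heg, hb⟩

theorem IsCritical.dirichlet_le (hh : IsCritical χ h) (hχ : IsTruncation χ) :
    dirichlet h ≤ 2 * (27 / (256 * criticalParam χ ^ 3)) := by
  have h1 := hh.memL2.bulk_le hχ (criticalParam_pos hχ)
  have h2 := hh.excess_eq
  rw [excess] at h2
  linarith

/-- Least integral is the selection rule that yields adjacency: a different nontrivial minimizer
lying below would have a smaller integral. -/
theorem exists_isCritical_integral_minimal (hχ : IsTruncation χ) :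
    ∃ h, IsCritical χ h ∧ bulk χ (criticalParam χ) h ≠ 0 ∧
      ∀ k, IsCritical χ k → bulk χ (criticalParam χ) k ≠ 0 →
        ∫ t in (0 : ℝ)..1, primitive h t ≤ ∫ t in (0 : ℝ)..1, primitive k t := by
  set S : Set ℝ := {x | ∃ h, IsCritical χ h ∧ bulk χ (criticalParam χ) h ≠ 0 ∧
    ∫ t in (0 : ℝ)..1, primitive h t = x}
  have hne : S.Nonempty := by
    obtain ⟨h, h1, h2⟩ := exists_isCritical hχ
    exact ⟨_, h, h1, h2, rfl⟩
  set K := 2 * (27 / (256 * criticalParam χ ^ 3))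
  have hbdd : BddBelow S := by
    refine ⟨-(1 + K), ?_⟩
    rintro _ ⟨h, h1, -, rfl⟩
    have := intervalIntegral.integral_mono_on zero_le_one (f := fun _ => -(1 + K)) (by simp)
      (h1.memL2.primitive_continuousOn.intervalIntegrable_unit zero_mem_unit one_mem_unit)
      fun t ht => (abs_le.1 (abs_primitive_le h1.memL2 (h1.dirichlet_le hχ) ht)).1
    simpa using this
  obtain ⟨x, -, hx, hmem⟩ := exists_seq_tendsto_sInf hne hbdd
  choose H hH hb hHx using hmem
  obtain ⟨g, hg, heg, hbg, σ, hσ, hint⟩ := exists_limit_excess_nonpos hχ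
    (fun n => (hH n).toAdmissible) (u := fun _ => criticalParam χ) tendsto_const_nhds
    (criticalParam_pos hχ) (fun _ => le_rfl) (fun n => (hH n).excess_eq.le) hb
  refine ⟨g, hg.isCritical hχ heg, hbg, fun k hk hbk => ?_⟩
  simp only [hHx] at hint
  rw [tendsto_nhds_unique hint (hx.comp hσ.tendsto_atTop)]
  exact csInf_le hbdd ⟨k, hk, hbk, rfl⟩

theorem primitive_add_integral (hh : MemL2Unit h) {p q : ℝ} (hp : p ∈ Icc (0 : ℝ) 1)
    (hq : q ∈ Icc (0 : ℝ) 1) : primitive h p + ∫ t in p..q, h t = primitive h q :=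
  intervalIntegral.integral_add_adjacent_intervals
    (hh.intervalIntegrable zero_mem_unit hp) (hh.intervalIntegrable hp hq)

/-! ### Critical deviations are affine below the activation threshold -/

/-- Compare with the deviation replaced by its chord on [p, q]. Both stay below the threshold there,
so the potential terms agree and minimality compares the Dirichlet integrals. -/
theorem IsCritical.integral_sq_le (hh : IsCritical χ h) (hχ : IsTruncation χ) {p q m : ℝ}
    (hp : p ∈ Icc (0 : ℝ) 1) (hq : q ∈ Icc (0 : ℝ) 1) (hpq : p < q)
    (hw : ∀ t ∈ Icc p q, primitive h t ≤ 3 / 4) (hm : ∫ t in p..q, h t = m * (q - p)) :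
    ∫ t in p..q, h t ^ 2 ≤ m ^ 2 * (q - p) := by
  classical
  set k : ℝ → ℝ := (Ioc p q).piecewise (fun _ => m) h
  have hk : MemL2Unit k := by
    refine MemLp.piecewise measurableSet_Ioc ?_ (hh.memL2.restrict _)
    exact memLp_const m
  have hin : ∀ t ∈ Ioc p q, k t = m := fun t ht => piecewise_eq_of_mem _ _ _ ht
  have hout : ∀ t ∉ Ioc p q, k t = h t := fun t ht => piecewise_eq_of_notMem _ _ _ ht
  have hkp : ∀ t ∈ Icc 0 p, primitive k t = primitive h t := fun t ht => by
    refine intervalIntegral.integral_congr_ae (Filter.Eventually.of_forall fun s hs => hout s ?_)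
    rw [uIoc_of_le ht.1] at hs
    exact fun hs' => absurd (hs.2.trans ht.2) (not_le.2 hs'.1)
  have hkm : ∀ t ∈ Icc p q, primitive k t = primitive h p + m * (t - p) := fun t ht => by
    have ht' : t ∈ Icc (0 : ℝ) 1 := ⟨hp.1.trans ht.1, ht.2.trans hq.2⟩
    rw [← primitive_add_integral hk hp ht', hkp p ⟨hp.1, le_rfl⟩]
    congr 1
    rw [intervalIntegral.integral_congr_ae (g := fun _ => m)
      (Filter.Eventually.of_forall fun s hs => ?_), intervalIntegral.integral_const]
    · simp; ring
    · rw [uIoc_of_le ht.1] at hs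
      exact hin s ⟨hs.1, hs.2.trans ht.2⟩
  have hkq : ∀ t ∈ Icc q 1, primitive k t = primitive h t := fun t ht => by
    have ht' : t ∈ Icc (0 : ℝ) 1 := ⟨hq.1.trans ht.1, ht.2⟩
    rw [← primitive_add_integral hk hq ht', ← primitive_add_integral hh.memL2 hq ht',
      hkm q ⟨hpq.le, le_rfl⟩, ← hm, primitive_add_integral hh.memL2 hp hq]
    congr 1
    refine intervalIntegral.integral_congr_ae (Filter.Eventually.of_forall fun s hs => hout s ?_)
    rw [uIoc_of_le ht.1] at hs
    exact fun hs' => absurd hs'.2 (not_le.2 hs.1)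
  have hq' : primitive h q = primitive h p + m * (q - p) := by
    rw [← hm, primitive_add_integral hh.memL2 hp hq]
  have hadm : Admissible k := ⟨hk, by rw [hkq 1 ⟨hq.2, le_rfl⟩, hh.primitive_one]⟩
  have hbulk : bulk χ (criticalParam χ) k = bulk χ (criticalParam χ) h := by
    refine intervalIntegral.integral_congr fun t ht => ?_
    rw [uIcc_of_le zero_le_one] at ht
    rcases le_total t p with h1 | h1
    · rw [profile, hkp t ⟨ht.1, h1⟩, profile]
    rcases le_total q t with h2 | h2
    · rw [profile, hkq t ⟨h2, ht.2⟩, profile]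
    · rw [hχ.potentialF_eq_zero _ (profile_le_one (hw t ⟨h1, h2⟩)),
        hχ.potentialF_eq_zero _ (profile_le_one ?_)]
      rw [hkm t ⟨h1, h2⟩]
      have ha := hw p ⟨le_rfl, hpq.le⟩
      have hb := hw q ⟨hpq.le, le_rfl⟩
      rw [hq'] at hb
      rcases le_total 0 m with h0 | h0
      · nlinarith
      · nlinarith
  have hsplit : ∀ g, MemL2Unit g → dirichlet g = (∫ t in (0 : ℝ)..p, g t ^ 2) +
      (∫ t in p..q, g t ^ 2) + ∫ t in q..1, g t ^ 2 := fun g hg => by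
    rw [intervalIntegral.integral_add_adjacent_intervals (hg.intervalIntegrable_sq zero_mem_unit hp)
      (hg.intervalIntegrable_sq hp hq), hg.dirichlet_split hq]
  have e1 : ∫ t in (0 : ℝ)..p, k t ^ 2 = ∫ t in (0 : ℝ)..p, h t ^ 2 := by
    refine intervalIntegral.integral_congr_ae (Filter.Eventually.of_forall fun s hs => ?_)
    rw [uIoc_of_le hp.1] at hs
    rw [hout s fun hs' => absurd hs.2 (not_le.2 hs'.1)]
  have e2 : ∫ t in p..q, k t ^ 2 = m ^ 2 * (q - p) := by
    rw [intervalIntegral.integral_congr_ae (g := fun _ => m ^ 2)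
      (Filter.Eventually.of_forall fun s hs => ?_), intervalIntegral.integral_const]
    · simp; ring
    · rw [uIoc_of_le hpq.le] at hs
      rw [hin s hs]
  have e3 : ∫ t in q..1, k t ^ 2 = ∫ t in q..1, h t ^ 2 := by
    refine intervalIntegral.integral_congr_ae (Filter.Eventually.of_forall fun s hs => ?_)
    rw [uIoc_of_le hq.2] at hs
    rw [hout s fun hs' => absurd hs'.2 (not_le.2 hs.1)]
  have h1 := hadm.excess_nonneg hχ
  have h2 := hh.excess_eq
  rw [excess, hsplit _ hh.memL2] at h2
  rw [excess, hbulk, hsplit _ hk, e1, e2, e3] at h1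
  linarith

/-- With m the mean of h on [p, q], the preceding bound forces ∫(h - m)² ≤ 0. -/
theorem IsCritical.primitive_affine (hh : IsCritical χ h) (hχ : IsTruncation χ) {p q : ℝ}
    (hp : p ∈ Icc (0 : ℝ) 1) (hq : q ∈ Icc (0 : ℝ) 1) (hpq : p < q)
    (hw : ∀ t ∈ Icc p q, primitive h t ≤ 3 / 4) :
    ∃ m, ∀ t ∈ Icc p q, primitive h t = primitive h p + m * (t - p) := by
  have hd : 0 < q - p := sub_pos.2 hpq
  set m := (∫ t in p..q, h t) / (q - p)
  have hm : ∫ t in p..q, h t = m * (q - p) := by simp only [m]; field_simp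
  refine ⟨m, fun t ht => ?_⟩
  have ht' : t ∈ Icc (0 : ℝ) 1 := ⟨hp.1.trans ht.1, ht.2.trans hq.2⟩
  have h1 := hh.integral_sq_le hχ hp hq hpq hw hm
  have h2 := hh.memL2.integral_sub_const_sq hp hq m
  rw [hm] at h2
  have hk : MemL2Unit (fun t => h t - m) := hh.memL2.sub (memLp_const m)
  have h3 := hk.sq_integral_le hp ht' ht.1
  have h4 : (∫ s in p..t, (h s - m) ^ 2) ≤ ∫ s in p..q, (h s - m) ^ 2 :=
    intervalIntegral.integral_mono_interval le_rfl ht.1 ht.2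
      (Filter.Eventually.of_forall fun s => sq_nonneg _) (hk.intervalIntegrable_sq hp hq)
  have h5 : (∫ s in p..t, (h s - m) ^ 2) ≤ 0 := by nlinarith
  have h6 : (∫ s in p..t, (h s - m)) ^ 2 ≤ 0 :=
    h3.trans (mul_nonpos_of_nonneg_of_nonpos (sub_nonneg.2 ht.1) h5)
  have h7 : ∫ s in p..t, (h s - m) = 0 := pow_eq_zero_iff two_ne_zero |>.1
    (le_antisymm h6 (sq_nonneg _))
  rw [intervalIntegral.integral_sub (hh.memL2.intervalIntegrable hp ht') (by simp),
    intervalIntegral.integral_const, smul_eq_mul] at h7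
  rw [← primitive_add_integral hh.memL2 hp ht']
  linarith

theorem exists_last_level_point {w : ℝ → ℝ} {a b c : ℝ} (hab : a ≤ b)
    (hw : ContinuousOn w (Icc a b)) (ha : w a ≤ c) (hb : w b ≤ c) :
    ∃ p ∈ Icc a b, (w p = c ∨ p = a) ∧ ∀ s ∈ Icc p b, w s ≤ c := by
  -- Adding the left endpoint keeps the set nonempty when the level is never attained; after its
  -- supremum the intermediate value theorem excludes values above c.
  set A : Set ℝ := (Icc a b ∩ w ⁻¹' {c}) ∪ {a}
  have hA : IsCompact A := (isCompact_Icc.of_isClosed_subset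
    (hw.preimage_isClosed_of_isClosed isClosed_Icc isClosed_singleton) inter_subset_left).union
    isCompact_singleton
  have hmem : sSup A ∈ A := hA.sSup_mem ⟨a, Or.inr rfl⟩
  have hsub : A ⊆ Icc a b :=
    union_subset inter_subset_left (singleton_subset_iff.2 ⟨le_rfl, hab⟩)
  have hle : w (sSup A) ≤ c := by
    rcases hmem with h | h
    · exact (show w (sSup A) = c from h.2).le
    · rw [show sSup A = a from h]; exact ha
  refine ⟨sSup A, hsub hmem, hmem.imp (fun h => h.2) id, fun s hs => ?_⟩
  by_contra hlt
  rw [not_le] at hlt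
  have has : a ≤ s := (hsub hmem).1.trans hs.1
  obtain ⟨r, hr, hrc⟩ := intermediate_value_Icc' hs.2 (hw.mono (Icc_subset_Icc_left has))
    ⟨hb, hlt.le⟩
  have h1 : r ≤ sSup A := le_csSup hA.bddAbove (Or.inl ⟨⟨has.trans hr.1, hr.2⟩, hrc⟩)
  have h2 : s = sSup A := le_antisymm (hr.1.trans h1) hs.1
  rw [h2] at hlt
  exact absurd hle (not_le.2 hlt)

/-- Nontrivial minimizers lie strictly above `t * (1 - t)`. -/
theorem IsCritical.primitive_pos (hh : IsCritical χ h) (hχ : IsTruncation χ)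
    (hb : bulk χ (criticalParam χ) h ≠ 0) {t : ℝ} (ht : t ∈ Ioo (0 : ℝ) 1) :
    0 < primitive h t := by
  by_contra hneg
  rw [not_lt] at hneg
  have hc := hh.memL2.primitive_continuousOn
  obtain ⟨p, hp, hp', hpw⟩ := exists_last_level_point (c := 3 / 4) ht.1.le
    (hc.mono (Icc_subset_Icc_right ht.2.le)) (by rw [primitive_zero]; norm_num)
    (hneg.trans (by norm_num))
  -- The same lemma for the reflection finds the first point after t at level 3/4, namely 1 - q.
  obtain ⟨q, hq, hq', hqw⟩ := exists_last_level_point (w := fun s => primitive h (1 - s))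
    (c := 3 / 4) (a := 0) (b := 1 - t) (by linarith [ht.2])
    (hc.comp (by fun_prop) fun s hs => ⟨by linarith [hs.2, ht.1], by linarith [hs.1]⟩)
    (by rw [sub_zero, hh.primitive_one]; norm_num)
    (by rw [sub_sub_cancel]; exact hneg.trans (by norm_num))
  have hw : ∀ s ∈ Icc p (1 - q), primitive h s ≤ 3 / 4 := fun s hs => by
    rcases le_total s t with h1 | h1
    · exact hpw s ⟨hs.1, h1⟩
    · have := hqw (1 - s) ⟨by linarith [hs.2], by linarith⟩
      rwa [sub_sub_cancel] at this
  have hpt : p < t := by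
    rcases hp' with h1 | h1
    · refine lt_of_le_of_ne hp.2 fun h2 => ?_
      rw [h2] at h1; linarith
    · rw [h1]; exact ht.1
  have hqt : t < 1 - q := by
    rcases hq' with h1 | h1
    · refine lt_of_le_of_ne (by linarith [hq.2]) fun h2 => ?_
      rw [← h2] at h1; linarith
    · rw [h1]; linarith [ht.2]
  obtain ⟨m, hm⟩ := hh.primitive_affine hχ ⟨hp.1, by linarith [ht.2]⟩
    ⟨by linarith [ht.1], by linarith [hq.1]⟩ (hpt.trans hqt) hw
  have e1 := hm t ⟨hpt.le, hqt.le⟩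
  have e2 := hm (1 - q) ⟨(hpt.trans hqt).le, le_rfl⟩
  -- The value at t is a convex combination of the endpoint values, each 3/4 or a boundary value 0.
  -- One 3/4 already makes it positive.
  have e3 : (1 - q - p) * primitive h t
      = (1 - q - t) * primitive h p + (t - p) * primitive h (1 - q) := by
    rw [e1, e2]; ring
  have hq1 : 0 < 1 - q - t := by linarith
  have hp1 : 0 < t - p := by linarith
  have h4 : (1 - q - p) * primitive h t ≤ 0 :=
    mul_nonpos_of_nonneg_of_nonpos (by linarith) hneg
  rcases hp' with h1 | h1
  · rcases hq' with h2 | h2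
    · rw [h1, h2] at e3; linarith
    · rw [h1, h2, sub_zero, hh.primitive_one] at e3
      rw [h2] at hq1 h4
      linarith
  · rcases hq' with h2 | h2
    · rw [h1, h2, primitive_zero] at e3
      rw [h1] at hp1 h4
      linarith
    -- Both endpoints are those of the unit interval: the threshold is never passed and the
    -- potential term vanishes.
    · rw [h1, h2, sub_zero] at hw
      exact hb (bulk_eq_zero hχ hw)

theorem IsCritical.primitive_eq_zero (hh : IsCritical χ h)
    (hb : bulk χ (criticalParam χ) h = 0) {t : ℝ} (ht : t ∈ Icc (0 : ℝ) 1) :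
    primitive h t = 0 := by
  have h1 := hh.excess_eq
  rw [excess, hb] at h1
  have h2 := hh.memL2.sq_primitive_le ht
  exact pow_eq_zero_iff two_ne_zero |>.1 (le_antisymm (by linarith) (sq_nonneg _))

/-! ### Symmetrization -/

theorem half_mem_unit : (1 / 2 : ℝ) ∈ Icc (0 : ℝ) 1 := by norm_num

/-- The function equal to `a` on the left half and to `b` on the right half of the interval. -/
noncomputable def splice (a b : ℝ → ℝ) (t : ℝ) : ℝ := if t ≤ 1 / 2 then a t else b t

theorem MemL2Unit.splice {a b : ℝ → ℝ} (ha : MemL2Unit a) (hb : MemL2Unit b) :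
    MemL2Unit (splice a b) := by
  classical
  have : MemL2Unit ((Iic (1 / 2 : ℝ)).piecewise a b) :=
    MemLp.piecewise measurableSet_Iic (ha.restrict _) (hb.restrict _)
  exact this

theorem splice_left {a b : ℝ → ℝ} {t : ℝ} (ht : t ≤ 1 / 2) : splice a b t = a t := if_pos ht

theorem splice_right {a b : ℝ → ℝ} {t : ℝ} (ht : 1 / 2 < t) : splice a b t = b t :=
  if_neg (not_le.2 ht)

theorem primitive_splice_left (a b : ℝ → ℝ) {t : ℝ} (ht : t ∈ Icc (0 : ℝ) (1 / 2)) :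
    primitive (splice a b) t = primitive a t := by
  refine intervalIntegral.integral_congr_ae (Filter.Eventually.of_forall fun s hs => ?_)
  rw [uIoc_of_le ht.1] at hs
  exact splice_left (hs.2.trans ht.2)

theorem primitive_splice_right {a b : ℝ → ℝ} (ha : MemL2Unit a) (hb : MemL2Unit b)
    (hab : primitive a (1 / 2) = primitive b (1 / 2)) {t : ℝ} (ht : t ∈ Icc (1 / 2 : ℝ) 1) :
    primitive (splice a b) t = primitive b t := by
  have ht' : t ∈ Icc (0 : ℝ) 1 := ⟨half_mem_unit.1.trans ht.1, ht.2⟩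
  rw [← primitive_add_integral (ha.splice hb) half_mem_unit ht',
    ← primitive_add_integral hb half_mem_unit ht', primitive_splice_left a b (by norm_num), hab]
  congr 1
  refine intervalIntegral.integral_congr_ae (Filter.Eventually.of_forall fun s hs => ?_)
  rw [uIoc_of_le ht.1] at hs
  exact splice_right hs.1

/-- Exchanging the halves of two integrands preserves the sum of the integrals. -/
theorem integral_exchange_halves {A B C D : ℝ → ℝ}
    (hA : IntegrableOn A (Ioo 0 1)) (hB : IntegrableOn B (Ioo 0 1))
    (hC : IntegrableOn C (Ioo 0 1)) (hD : IntegrableOn D (Ioo 0 1))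
    (hCl : ∀ t ∈ Icc (0 : ℝ) (1 / 2), C t = A t) (hCr : ∀ t ∈ Ioc (1 / 2 : ℝ) 1, C t = B t)
    (hDl : ∀ t ∈ Icc (0 : ℝ) (1 / 2), D t = B t) (hDr : ∀ t ∈ Ioc (1 / 2 : ℝ) 1, D t = A t) :
    (∫ t in (0 : ℝ)..1, C t) + ∫ t in (0 : ℝ)..1, D t
      = (∫ t in (0 : ℝ)..1, A t) + ∫ t in (0 : ℝ)..1, B t := by
  have hs : ∀ {f : ℝ → ℝ}, IntegrableOn f (Ioo 0 1) → ∫ t in (0 : ℝ)..1, f t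
      = (∫ t in (0 : ℝ)..(1 / 2), f t) + ∫ t in (1 / 2 : ℝ)..1, f t := fun hf =>
    (intervalIntegral.integral_add_adjacent_intervals
      (IntegrableOn.intervalIntegrable_of_mem_Icc hf zero_mem_unit half_mem_unit)
      (IntegrableOn.intervalIntegrable_of_mem_Icc hf half_mem_unit one_mem_unit)).symm
  have hl : ∀ {f g : ℝ → ℝ}, (∀ t ∈ Icc (0 : ℝ) (1 / 2), f t = g t) →
      ∫ t in (0 : ℝ)..(1 / 2), f t = ∫ t in (0 : ℝ)..(1 / 2), g t := fun e =>
    intervalIntegral.integral_congr fun t ht => e t (by rwa [uIcc_of_le (by norm_num)] at ht)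
  have hr : ∀ {f g : ℝ → ℝ}, (∀ t ∈ Ioc (1 / 2 : ℝ) 1, f t = g t) →
      ∫ t in (1 / 2 : ℝ)..1, f t = ∫ t in (1 / 2 : ℝ)..1, g t := fun e =>
    intervalIntegral.integral_congr_ae (Filter.Eventually.of_forall fun t ht =>
      e t (by rwa [uIoc_of_le (by norm_num)] at ht))
  rw [hs hA, hs hB, hs hC, hs hD, hl hCl, hl hDl, hr hCr, hr hDr]
  ring

theorem dirichlet_splice_add {a b : ℝ → ℝ} (ha : MemL2Unit a) (hb : MemL2Unit b) :
    dirichlet (splice a b) + dirichlet (splice b a) = dirichlet a + dirichlet b :=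
  integral_exchange_halves (MemLp.integrable_sq ha) (MemLp.integrable_sq hb)
    (MemLp.integrable_sq (ha.splice hb)) (MemLp.integrable_sq (hb.splice ha))
    (fun t ht => by rw [splice_left ht.2]) (fun t ht => by rw [splice_right ht.1])
    (fun t ht => by rw [splice_left ht.2]) (fun t ht => by rw [splice_right ht.1])

theorem integral_comp_primitive_splice_add {a b : ℝ → ℝ} (ha : MemL2Unit a) (hb : MemL2Unit b)
    (hab : primitive a (1 / 2) = primitive b (1 / 2)) {G : ℝ → ℝ → ℝ}
    (hG : ∀ k, MemL2Unit k → ContinuousOn (fun t => G t (primitive k t)) (Icc 0 1)) :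
    (∫ t in (0 : ℝ)..1, G t (primitive (splice a b) t)) +
        ∫ t in (0 : ℝ)..1, G t (primitive (splice b a) t)
      = (∫ t in (0 : ℝ)..1, G t (primitive a t)) + ∫ t in (0 : ℝ)..1, G t (primitive b t) :=
  integral_exchange_halves (hG a ha).integrableOn_Ioo_unit (hG b hb).integrableOn_Ioo_unit
    (hG _ (ha.splice hb)).integrableOn_Ioo_unit (hG _ (hb.splice ha)).integrableOn_Ioo_unit
    (fun t ht => by rw [primitive_splice_left a b ht])
    (fun t ht => by rw [primitive_splice_right ha hb hab (Ioc_subset_Icc_self ht)])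
    (fun t ht => by rw [primitive_splice_left b a ht])
    (fun t ht => by rw [primitive_splice_right hb ha hab.symm (Ioc_subset_Icc_self ht)])

/-- The excesses of the two splices add up to those of a and b, hence to zero; both being
nonnegative, each vanishes. -/
theorem IsCritical.splice {a b : ℝ → ℝ} (hχ : IsTruncation χ) (ha : IsCritical χ a)
    (hb : IsCritical χ b) (hab : primitive a (1 / 2) = primitive b (1 / 2)) :
    IsCritical χ (splice a b) := by
  have h1 : Admissible (_root_.splice a b) := ⟨ha.memL2.splice hb.memL2, by
    rw [primitive_splice_right ha.memL2 hb.memL2 hab (by norm_num), hb.primitive_one]⟩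
  have h2 : Admissible (_root_.splice b a) := ⟨hb.memL2.splice ha.memL2, by
    rw [primitive_splice_right hb.memL2 ha.memL2 hab.symm (by norm_num), ha.primitive_one]⟩
  have e1 := dirichlet_splice_add ha.memL2 hb.memL2
  have e2 : bulk χ (criticalParam χ) (_root_.splice a b) +
      bulk χ (criticalParam χ) (_root_.splice b a)
      = bulk χ (criticalParam χ) a + bulk χ (criticalParam χ) b :=
    integral_comp_primitive_splice_add ha.memL2 hb.memL2 hab
      (G := fun t x => potentialF χ (criticalParam χ) (t * (1 - t) + x))
      fun k hk => hk.potentialF_profile_continuousOn hχ _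
  refine h1.isCritical hχ ?_
  have h3 := h2.excess_nonneg hχ
  have h4 := ha.excess_eq
  have h5 := hb.excess_eq
  simp only [excess] at *
  linarith

/-- The derivative of the reflection `t ↦ w (1 - t)` of the primitive `w` of `h`. -/
def reflected (h : ℝ → ℝ) (t : ℝ) : ℝ := -h (1 - t)

theorem MemL2Unit.reflected (hh : MemL2Unit h) : MemL2Unit (reflected h) := by
  have hmp := (Measure.measurePreserving_sub_left (volume : Measure ℝ) 1).restrict_preimage
    (measurableSet_Ioo (a := (0 : ℝ)) (b := 1))
  have hpre : (fun t : ℝ => 1 - t) ⁻¹' Ioo 0 1 = Ioo 0 1 := by simp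
  rw [hpre] at hmp
  exact (hh.comp_measurePreserving hmp).neg

theorem Admissible.primitive_reflected (hh : Admissible h) {t : ℝ} (ht : t ∈ Icc (0 : ℝ) 1) :
    primitive (reflected h) t = primitive h (1 - t) := by
  have ht' : 1 - t ∈ Icc (0 : ℝ) 1 := ⟨by linarith [ht.2], by linarith [ht.1]⟩
  have h1 := primitive_add_integral hh.memL2 ht' one_mem_unit
  have h2 : primitive (reflected h) t = -∫ s in (1 - t)..1, h s := by
    simp only [primitive, reflected, intervalIntegral.integral_neg,
      intervalIntegral.integral_comp_sub_left, sub_zero]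
  rw [hh.primitive_one] at h1
  linarith

theorem dirichlet_reflected (h : ℝ → ℝ) : dirichlet (reflected h) = dirichlet h := by
  simp only [dirichlet, reflected, neg_sq]
  rw [intervalIntegral.integral_comp_sub_left (fun s => h s ^ 2)]
  simp

theorem Admissible.bulk_reflected (hh : Admissible h) (χ : ℝ → ℝ) (l : ℝ) :
    bulk χ l (reflected h) = bulk χ l h := by
  have e : bulk χ l (reflected h)
      = ∫ t in (0 : ℝ)..1, potentialF χ l (profile h (1 - t)) := by
    refine intervalIntegral.integral_congr fun t ht => ?_
    rw [uIcc_of_le zero_le_one] at ht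
    simp only [profile, hh.primitive_reflected ht]
    congr 2
    ring
  rw [e, intervalIntegral.integral_comp_sub_left (fun s => potentialF χ l (profile h s))]
  simp [bulk]

theorem IsCritical.reflected (hh : IsCritical χ h) : IsCritical χ (reflected h) := by
  refine ⟨⟨hh.memL2.reflected, ?_⟩, ?_⟩
  · rw [hh.primitive_reflected one_mem_unit, sub_self, primitive_zero]
  · rw [excess, dirichlet_reflected, hh.bulk_reflected]
    exact hh.excess_eq

/-- A nontrivial minimizer of least integral can be chosen symmetric. -/
theorem exists_symmetric_integral_minimal (hχ : IsTruncation χ) :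
    ∃ h, IsCritical χ h ∧ bulk χ (criticalParam χ) h ≠ 0 ∧
      (∀ k, IsCritical χ k → bulk χ (criticalParam χ) k ≠ 0 →
        ∫ t in (0 : ℝ)..1, primitive h t ≤ ∫ t in (0 : ℝ)..1, primitive k t) ∧
      ∀ t ∈ Icc (0 : ℝ) 1, primitive h (1 - t) = primitive h t := by
  obtain ⟨h, hh, hb, hmin⟩ := exists_isCritical_integral_minimal hχ
  have hr := hh.reflected
  have hhalf : primitive h (1 / 2) = primitive (reflected h) (1 / 2) := by
    rw [hh.primitive_reflected half_mem_unit]; norm_num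
  have h1 := IsCritical.splice hχ hh hr hhalf
  have h2 := IsCritical.splice hχ hr hh hhalf.symm
  -- A splice inherits nontriviality from the half taken from h, where the deviation is positive.
  have hb1 : bulk χ (criticalParam χ) (splice h (reflected h)) ≠ 0 := fun h0 => by
    have e := h1.primitive_eq_zero h0 (t := 1 / 4) (by norm_num)
    rw [primitive_splice_left _ _ (by norm_num)] at e
    exact (hh.primitive_pos hχ hb (t := 1 / 4) (by norm_num)).ne' e
  have hb2 : bulk χ (criticalParam χ) (splice (reflected h) h) ≠ 0 := fun h0 => by
    have e := h2.primitive_eq_zero h0 (t := 3 / 4) (by norm_num)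
    rw [primitive_splice_right hr.memL2 hh.memL2 hhalf.symm (by norm_num)] at e
    exact (hh.primitive_pos hχ hb (t := 3 / 4) (by norm_num)).ne' e
  have e1 : (∫ t in (0 : ℝ)..1, primitive (splice h (reflected h)) t) +
      ∫ t in (0 : ℝ)..1, primitive (splice (reflected h) h) t
      = (∫ t in (0 : ℝ)..1, primitive h t) + ∫ t in (0 : ℝ)..1, primitive (reflected h) t :=
    integral_comp_primitive_splice_add hh.memL2 hr.memL2 hhalf (G := fun _ x => x)
      fun k hk => hk.primitive_continuousOn
  have e2 : ∫ t in (0 : ℝ)..1, primitive (reflected h) t = ∫ t in (0 : ℝ)..1, primitive h t := by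
    have : ∫ t in (0 : ℝ)..1, primitive (reflected h) t
        = ∫ t in (0 : ℝ)..1, primitive h (1 - t) :=
      intervalIntegral.integral_congr fun t ht =>
        hh.primitive_reflected (by rwa [uIcc_of_le zero_le_one] at ht)
    rw [this, intervalIntegral.integral_comp_sub_left (fun s => primitive h s)]
    simp
  -- The two splices have integrals adding up to twice the minimum and each at least the minimum, so
  -- both attain it.
  refine ⟨_, h1, hb1, fun k hk hbk => ?_, fun t ht => ?_⟩
  · have := hmin _ h2 hb2
    have := hmin k hk hbk
    linarith
  · rcases le_total t (1 / 2) with h3 | h3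
    · rw [primitive_splice_right hh.memL2 hr.memL2 hhalf ⟨by linarith, by linarith [ht.1]⟩,
        primitive_splice_left _ _ ⟨ht.1, h3⟩,
        hh.primitive_reflected ⟨by linarith [ht.2], by linarith [ht.1]⟩, sub_sub_cancel]
    · rw [primitive_splice_left _ _ ⟨by linarith [ht.2], by linarith⟩,
        primitive_splice_right hh.memL2 hr.memL2 hhalf ⟨h3, ht.2⟩, hh.primitive_reflected ht]

/-! ### Global minimizers at the critical parameter -/

theorem IsCritical.isGlobalMinimizer (hh : IsCritical χ h) (hχ : IsTruncation χ) {ψ : ℝ → ℝ}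
    (hψ : ∀ t ∈ Icc (0 : ℝ) 1, ψ t = profile h t) :
    IsGlobalMinimizer (nonlinearity χ (criticalParam χ)) 0 ψ := by
  obtain ⟨hm, he⟩ := hh.energy_eq hχ hψ
  refine ⟨hm, fun η hη => ?_⟩
  obtain ⟨k, hk, hkη⟩ := hη.exists_admissible
  rw [he, hh.excess_eq, (hk.energy_eq hχ hkη).2]
  linarith [hk.excess_nonneg hχ]

theorem primitive_zero_fun (t : ℝ) : primitive (fun _ => 0) t = 0 := by simp [primitive]

theorem isCritical_zero (hχ : IsTruncation χ) : IsCritical χ (fun _ => 0) := by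
  refine ⟨⟨memLp_const 0, primitive_zero_fun 1⟩, ?_⟩
  rw [excess, bulk_eq_zero hχ fun t _ => by rw [primitive_zero_fun]; norm_num]
  simp [dirichlet]

theorem profile_zero_fun (t : ℝ) : profile (fun _ => 0) t = t * (1 - t) := by
  rw [profile, primitive_zero_fun, add_zero]

/-- Comparison with t(1-t), of energy -1/6, gives nonpositive excess. -/
theorem IsGlobalMinimizer.exists_isCritical (hχ : IsTruncation χ) {η : ℝ → ℝ}
    (hη : IsGlobalMinimizer (nonlinearity χ (criticalParam χ)) 0 η) :
    ∃ k, IsCritical χ k ∧ ∀ t ∈ Icc (0 : ℝ) 1, η t = profile k t := by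
  obtain ⟨k, hk, hkη⟩ := hη.1.exists_admissible
  have h0 := (isCritical_zero hχ).energy_eq hχ (ψ := profile fun _ => 0) (fun _ _ => rfl)
  have h1 := hη.2 _ h0.1
  rw [h0.2, (isCritical_zero hχ).excess_eq, (hk.energy_eq hχ hkη).2] at h1
  exact ⟨k, hk.isCritical hχ (by linarith), hkη⟩

theorem mainTheorem5 :
    (∃ χ : ℝ → ℝ, IsTruncation χ) ∧
    ∀ χ : ℝ → ℝ, IsTruncation χ →
      (lowEnergySet χ).Nonempty ∧ BddAbove (lowEnergySet χ) ∧
      ContDiff ℝ ∞ (nonlinearity χ (criticalParam χ)) ∧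
      ∃ ϕ : ℝ → ℝ,
        AdjacentMinimizers (nonlinearity χ (criticalParam χ)) 0 (fun t => t * (1 - t)) ϕ ∧
        (∀ t ∈ Ioo (0 : ℝ) 1, 0 < t * (1 - t)) ∧
        (∀ t ∈ Ioo (0 : ℝ) 1, 0 < ϕ t) ∧
        (∀ t ∈ Icc (0 : ℝ) 1, ϕ (1 - t) = ϕ t) := by
  refine ⟨exists_isTruncation, fun χ hχ => ⟨lowEnergySet_nonempty hχ, lowEnergySet_bddAbove hχ,
    hχ.contDiff_nonlinearity _, ?_⟩⟩
  obtain ⟨h, hh, hb, hmin, hsymm⟩ := exists_symmetric_integral_minimal hχ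
  have hpos : ∀ t ∈ Ioo (0 : ℝ) 1, 0 < t * (1 - t) := fun t ht =>
    mul_pos ht.1 (sub_pos.2 ht.2)
  have hw : ∀ t ∈ Ioo (0 : ℝ) 1, 0 < primitive h t := fun t ht => hh.primitive_pos hχ hb ht
  refine ⟨profile h, ⟨(isCritical_zero hχ).isGlobalMinimizer hχ fun t _ => (profile_zero_fun t).symm,
    hh.isGlobalMinimizer hχ fun _ _ => rfl, fun t ht => ?_, fun η hη hbetween => ?_⟩, hpos,
    fun t ht => add_pos (hpos t ht) (hw t ht), fun t ht => ?_⟩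
  · change t * (1 - t) < t * (1 - t) + primitive h t
    linarith [hw t ht]
  · obtain ⟨k, hk, hkη⟩ := hη.exists_isCritical hχ
    by_cases hbk : bulk χ (criticalParam χ) k = 0
    · refine Or.inl fun t ht => ?_
      rw [hkη t ht, profile, hk.primitive_eq_zero hbk ht, add_zero]
    · refine Or.inr fun t ht => ?_
      have hle : ∀ s ∈ Icc (0 : ℝ) 1, primitive k s ≤ primitive h s := fun s hs => by
        have := (hbetween s hs).2
        rw [hkη s hs, profile, profile] at this
        linarith
      rw [hkη t ht, profile, profile]
      by_contra hne
      have hlt : primitive k t < primitive h t :=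
        lt_of_le_of_ne (hle t ht) fun e => hne (by rw [e])
      -- A continuous deviation below that of h and smaller somewhere has a strictly smaller
      -- integral, against the choice of h.
      have := intervalIntegral.integral_lt_integral_of_continuousOn_of_le_of_exists_lt zero_lt_one
        hk.memL2.primitive_continuousOn hh.memL2.primitive_continuousOn
        (fun s hs => hle s (Ioc_subset_Icc_self hs)) ⟨t, ht, hlt⟩
      exact absurd (hmin k hk hbk) (not_le.2 this)
  · rw [profile, profile, hsymm t ht]
    ring
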